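/- **Conventions.** Boxes of a Young diagram are written $(i,j)$ (row $i$, column $j$, English convention), and $(i,j)$ lies on the diagonal $D_{j-i}$. Letters are the symbols $1'<1<2'<2<\cdots$ (primed and unprimed positive integers). For a finite collection of letters, the associated monomial is $\prod_i x_i^{\beta_i}$, where $\beta_i$ is the total number of occurrences of $i$ and $i'$. For finite nonempty sets $A,B$ of letters, $A\le B$ means $\max A\le\min B$ and $A<B$ means $\max A<\min B$. **The functions $GQ_\mu$.** Let $\mu$ be a partition that is empty or whose last (smallest) part is at least its number of parts. Let $up(\mu)$ be the set of boxes of $\mu$ on diagonals $D_m$ with $m\ge 0$. A *shifted set-valued tableau* $T$ of shape $\mu$ fills each box of $up(\mu)$ with a finite nonempty set of letters and marks the other boxes by $X$, such that the sets weakly increase along rows and down columns, each unprimed letter $i$ occurs at most once in any column, and each primed letter $i'$ occurs at most once in any row. With $|up(T)|$ the total number of letters in $T$ and $x^T$ its monomial, $$GQ_\mu=\sum_{T}(-1)^{|up(T)|-|up(\mu)|}\,x^T ,$$ a formal power series in $x_1,x_2,\dots$. **2-quotient.** For $\lambda=(\lambda_1,\dots,\lambda_k)$ let $L=(l_1,\dots,l_k)$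 with $l_i=\lambda_i+k-i$. Let $M$ be obtained from $L$ by replacing the even components, from right to left, by $0,2,4,\dots$ and the odd components, from right to left, by $1,3,5,\dots$. The 2-quotient $(\mu,\nu)$ of $\lambda$ is obtained by halving the even (for $\mu$), respectively odd (for $\nu$), components of $L$ minus the corresponding components of $M$, and deleting zeros. **Pavings.** A paving of $\lambda$ is a decomposition of its diagram into dominoes ($1\times 2$ or $2\times 1$ rectangles). Each domino contains exactly one box on an even diagonal $D_{2k}$, and is said to lie on $D_{2k}$; it has type 1 if its other box is on $D_{2k-1}$ and type 2 if its other box is on $D_{2k+1}$. Let $(\mu,\nu)$ be the 2-quotient of $\lambda$. A paving of $\lambda$ is *shifted* if each of $\mu,\nu$ is empty or has last part at least its number of parts, and there is no vertical domino $d$ on $D_0$ such that there are dominoes directly left of and adjacent to $d$ and all of these lie strictly below $D_0$ (on $D_{2k}$ with $k<0$). If $\lambda$ has a shifted paving it is *shifted pavable*. For a shifted paving, $up(\lambda)$ is the set of its dominoes lying on $D_{2k}$ with $k\ge0$. **Shifted set-valued domino tableaux.** Such a tableau $T$ of shape $\lambda$ consists of a shifted paving of $\lambda$, a filling of each domino of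 $up(\lambda)$ with a finite nonempty set of letters, and the mark $X$ in all other dominoes, such that: 1. the minima of the sets weakly increase along rows and down columns, and for these minima each unprimed $i$ occurs in at most one domino meeting any given column, and each primed $i'$ occurs in at most one domino meeting any given row; 2. if $F_1,F_2$ are dominoes of $up(\lambda)$ of the same type, on neighboring even diagonals, and some box of $F_2$ is weakly southeast of the top left box of $F_1$, then $\max F_1\le\min F_2$, with strict inequality if $F_1$ is on $D_{2k}$, $F_2$ is on $D_{2(k+1)}$ and $\max F_1$ is primed, and also if $F_1$ is on $D_{2(k+1)}$, $F_2$ is on $D_{2k}$ and $\max F_1$ is unprimed. Let $up(T)$ be the set of dominoes in $up(\lambda)$ together with their fillings, $|up(T)|$ the number of letters in it, and $x^T$ its monomial. Tableaux $T,T'$ of shape $\lambda$ with $up(T)=up(T')$ are identified. **Statement.** Let $\lambda$ be a shifted pavable partition with 2-quotient $(\mu,\nu)$. Then each monomial arises from only finitely many shifted set-valued tableaux of shape $\mu$, of shape $\nu$, and from only finitely many (classes of) shifted set-valued domino tableaux of shape $\lambda$, so that all the sums are well-defined formal power series, and $$GQ_\mu\,GQ_\nu=\sum_{T}(-1)^{|up(T)|-|up(\lambda)|}\,x^T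 ,$$ where $T$ runs over all shifted set-valued domino tableaux of shape $\lambda$ up to this identification, and $|up(\lambda)|$ is the number of dominoes in $up(\lambda)$. -/

import Mathlib

namespace ShiftedDomino

/-! ### The alphabet, set-valued entries, and formal sums of monomials -/

/-- The alphabet `1' < 1 < 2' < 2 < ⋯`: the letter `i'` is `toLex (i, false)` and the letter `i` is
`toLex (i, true)`, ordered lexicographically. -/
abbrev Letter : Type := ℕ+ ×ₗ Bool

/-- The positive integer underlying a letter: `i` for both `i'` and `i`. -/
def Letter.index (a : Letter) : ℕ+ := (ofLex a).1

/-- The letter is of the form `i'`. -/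
def Letter.Primed (a : Letter) : Prop := (ofLex a).2 = false

/-- `A ≤ B` for (nonempty) finite sets of letters: `max A ≤ min B`. -/
def SetLE (A B : Finset Letter) : Prop := ∀ a ∈ A, ∀ b ∈ B, a ≤ b

/-- `A < B` for (nonempty) finite sets of letters: `max A < min B`. -/
def SetLT (A B : Finset Letter) : Prop := ∀ a ∈ A, ∀ b ∈ B, a < b

/-- The exponent vector of a finite set `A` of letters: its `i`-th component is the number of
elements of `A` that are equal to `i` or `i'`. -/
noncomputable def contentOf (A : Finset Letter) : ℕ+ →₀ ℕ :=
  ∑ a ∈ A, Finsupp.single a.index 1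

/-- The formal power series `∑ₜ sgn(t) x^{wt(t)}` in the variables `x₁, x₂, …`. It is meaningful
when every exponent vector is the weight of only finitely many `t`. -/
noncomputable def formalSum {ι : Type*} (wt : ι → (ℕ+ →₀ ℕ)) (sgn : ι → ℤ) :
    MvPowerSeries ℕ+ ℤ :=
  fun α => ∑ᶠ t : {t : ι // wt t = α}, sgn t

/-! ### Shifted set-valued tableaux and K-theoretic Q-Schur functions -/

/-- The boxes of `μ` weakly northeast of the main diagonal. -/
def upBoxes (μ : YoungDiagram) : Finset (ℕ × ℕ) := μ.cells.filter fun c => c.1 ≤ c.2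

/-- A shifted set-valued tableau of shape `μ`. The boxes outside `upBoxes μ` (in particular those
strictly southwest of the main diagonal, which are marked `X`) carry no letters, which is encoded
by the empty set. -/
structure ShiftedSVT (μ : YoungDiagram) where
  entry : ℕ × ℕ → Finset Letter
  entry_nonempty : ∀ c ∈ upBoxes μ, (entry c).Nonempty
  entry_eq_empty : ∀ c, c ∉ upBoxes μ → entry c = ∅
  row_weak : ∀ c ∈ upBoxes μ, ∀ e ∈ upBoxes μ, c.1 = e.1 → c.2 < e.2 → SetLE (entry c) (entry e)
  col_weak : ∀ c ∈ upBoxes μ, ∀ e ∈ upBoxes μ, c.2 = e.2 → c.1 < e.1 → SetLE (entry c) (entry e)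
  /-- There is at most one occurrence of the unprimed letter `i` in any column. -/
  col_unprimed : ∀ a : Letter, ¬ a.Primed → ∀ c ∈ upBoxes μ, ∀ e ∈ upBoxes μ, c.2 = e.2 →
    a ∈ entry c → a ∈ entry e → c = e
  /-- There is at most one occurrence of the primed letter `i'` in any row. -/
  row_primed : ∀ a : Letter, a.Primed → ∀ c ∈ upBoxes μ, ∀ e ∈ upBoxes μ, c.1 = e.1 →
    a ∈ entry c → a ∈ entry e → c = e

namespace ShiftedSVT

variable {μ : YoungDiagram}

/-- The exponent vector of the monomial `x^T`. -/
noncomputable def weight (T : ShiftedSVT μ) : ℕ+ →₀ ℕ := ∑ c ∈ upBoxes μ, contentOf (T.entry c)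

/-- `|up(T)|`, the number of primed and unprimed integers in `T`. -/
def size (T : ShiftedSVT μ) : ℕ := ∑ c ∈ upBoxes μ, (T.entry c).card

/-- `(-1)^{|up(T)| - |up(μ)|}`; the exponent is a genuine natural number because every box of
`upBoxes μ` contains at least one letter. -/
def sign (T : ShiftedSVT μ) : ℤ := (-1) ^ (T.size - (upBoxes μ).card)

end ShiftedSVT

/-- The K-theoretic Q-Schur function `GQ_μ = ∑_T (-1)^{|up(T)| - |up(μ)|} x^T`. -/
noncomputable def GQ (μ : YoungDiagram) : MvPowerSeries ℕ+ ℤ :=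
  formalSum (ShiftedSVT.weight (μ := μ)) ShiftedSVT.sign

/-! ### The 2-quotient -/

/-- `L = (l₁, …, l_k)` with `lᵢ = λᵢ + k - i` (indices starting from `1`). -/
def betaList (w : List ℕ) : List ℕ := w.mapIdx fun i a => a + (w.length - 1 - i)

/-- From a list `e = (e₁, …, e_m)`, subtract the list `(2(m-1) + r, …, 4 + r, 2 + r, r)`
componentwise, halve, and delete the components that are `0`. -/
def quotientPart (r : ℕ) (e : List ℕ) : List ℕ :=
  (e.mapIdx fun i a => (a - (2 * (e.length - 1 - i) + r)) / 2).filter fun a => a ≠ 0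

/-- The 2-quotient of the partition with list of parts `w`. -/
def twoQuotient (w : List ℕ) : List ℕ × List ℕ :=
  (quotientPart 0 ((betaList w).filter fun a => a % 2 = 0),
    quotientPart 1 ((betaList w).filter fun a => a % 2 = 1))

/-- `(μ, ν)` is the 2-quotient of `lam`. -/
def IsTwoQuotient (lam μ ν : YoungDiagram) : Prop :=
  twoQuotient lam.rowLens = (μ.rowLens, ν.rowLens)

/-- The last part of the partition `w` is at least its number of parts (no condition if `w` is
empty). -/
def LastPartGE (w : List ℕ) : Prop := ∀ a ∈ w.getLast?, w.length ≤ a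

/-! ### Dominoes and pavings

Boxes are pairs (row, column), numbered from `0`, rows going down. The diagonal `D_m` consists of
the boxes `(i, j)` with `j - i = m`. -/

/-- A domino, given by its top left box and its orientation. -/
structure Domino where
  row : ℕ
  col : ℕ
  vertical : Bool
deriving DecidableEq

/-- The index of the diagonal on which a box lies. -/
def boxDiag (c : ℕ × ℕ) : ℤ := (c.2 : ℤ) - (c.1 : ℤ)

namespace Domino

/-- The top left box. -/
def first (d : Domino) : ℕ × ℕ := (d.row, d.col)

/-- The other box: below the first one or to its right. -/
def second (d : Domino) : ℕ × ℕ :=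
  if d.vertical then (d.row + 1, d.col) else (d.row, d.col + 1)

def boxes (d : Domino) : Finset (ℕ × ℕ) := {d.first, d.second}

/-- The index `2k` of the unique even diagonal `D_{2k}` that crosses the domino. -/
def diag (d : Domino) : ℤ :=
  if Even (boxDiag d.first) then boxDiag d.first else boxDiag d.second

/-- Type 1: the diagonal `D_{2k}` cuts off a small triangle that points upward, that is, the box of
the domino not crossed by `D_{2k}` is southwest of `D_{2k}`. The other dominoes have type 2. -/
def IsType1 (d : Domino) : Prop := ∃ c ∈ d.boxes, boxDiag c < d.diag

def SameType (d e : Domino) : Prop := d.IsType1 ↔ e.IsType1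

/-- Part of `e` lies directly left of, and adjacent to, part of `d`. -/
def DirectlyLeft (e d : Domino) : Prop := ∃ c ∈ e.boxes, (c.1, c.2 + 1) ∈ d.boxes

/-- `e` is weakly southeast of `d`: some box of `e` is weakly southeast of the top left box
of `d`. -/
def WeaklySoutheast (e d : Domino) : Prop := ∃ c ∈ e.boxes, d.row ≤ c.1 ∧ d.col ≤ c.2

end Domino

/-- The set `P` of dominoes is a paving of `lam`. -/
structure IsPaving (lam : YoungDiagram) (P : Finset Domino) : Prop where
  disjoint : ∀ d ∈ P, ∀ e ∈ P, d ≠ e → Disjoint d.boxes e.boxes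
  cover : P.biUnion Domino.boxes = lam.cells

/-- The paving `P` of `lam` is a shifted paving. -/
structure IsShiftedPaving (lam : YoungDiagram) (P : Finset Domino) : Prop extends
    IsPaving lam P where
  lastPart_left : LastPartGE (twoQuotient lam.rowLens).1
  lastPart_right : LastPartGE (twoQuotient lam.rowLens).2
  /-- There is no vertical domino `d` on `D_0` that has dominoes directly left of it, all of which
  are strictly below `D_0`. -/
  no_bad_vertical : ¬ ∃ d ∈ P, d.vertical = true ∧ d.diag = 0 ∧
    (∃ e ∈ P, e.DirectlyLeft d) ∧ ∀ e ∈ P, e.DirectlyLeft d → e.diag < 0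

/-- `lam` is a shifted pavable partition. -/
def IsShiftedPavable (lam : YoungDiagram) : Prop := ∃ P : Finset Domino, IsShiftedPaving lam P

/-- The dominoes of `P` on a diagonal weakly northeast of `D_0`. -/
def upDominoes (P : Finset Domino) : Finset Domino := P.filter fun d => 0 ≤ d.diag

/-! ### Shifted domino tableaux and shifted set-valued domino tableaux -/

/-- Filling each domino `d` of `upDominoes P` with the letter `g d`, and the others with `X`, gives
a shifted domino tableau. -/
structure IsShiftedDominoFilling (P : Finset Domino) (g : Domino → Letter) : Prop where
  row_weak : ∀ d ∈ upDominoes P, ∀ e ∈ upDominoes P, ∀ x ∈ d.boxes, ∀ y ∈ e.boxes,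
    x.1 = y.1 → x.2 < y.2 → g d ≤ g e
  col_weak : ∀ d ∈ upDominoes P, ∀ e ∈ upDominoes P, ∀ x ∈ d.boxes, ∀ y ∈ e.boxes,
    x.2 = y.2 → x.1 < y.1 → g d ≤ g e
  /-- There is at most one occurrence of the unprimed letter `i` in any column. -/
  col_unprimed : ∀ d ∈ upDominoes P, ∀ e ∈ upDominoes P, ∀ x ∈ d.boxes, ∀ y ∈ e.boxes,
    x.2 = y.2 → g d = g e → ¬ (g d).Primed → d = e
  /-- There is at most one occurrence of the primed letter `i'` in any row. -/
  row_primed : ∀ d ∈ upDominoes P, ∀ e ∈ upDominoes P, ∀ x ∈ d.boxes, ∀ y ∈ e.boxes,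
    x.1 = y.1 → g d = g e → (g d).Primed → d = e

/-- A shifted set-valued domino tableau of shape `lam`. The dominoes that are not in
`upDominoes paving` (in particular those of the paving strictly southwest of `D_0`, which are
marked `X`) carry no letters, which is encoded by the empty set. -/
structure ShiftedSVDT (lam : YoungDiagram) where
  paving : Finset Domino
  isShiftedPaving : IsShiftedPaving lam paving
  entry : Domino → Finset Letter
  entry_nonempty : ∀ d ∈ upDominoes paving, (entry d).Nonempty
  entry_eq_empty : ∀ d, d ∉ upDominoes paving → entry d = ∅
  /-- Restricting to the minimum entry in each domino yields a shifted domino tableau. -/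
  min_filling : ∃ g : Domino → Letter,
    (∀ d ∈ upDominoes paving, IsLeast (entry d : Set Letter) (g d)) ∧
      IsShiftedDominoFilling paving g
  /-- `max(F₁) ≤ min(F₂)` if `F₁`, `F₂` have the same type, are on neighboring diagonals, and `F₂`
  is weakly southeast of `F₁`. -/
  southeast_le : ∀ d ∈ upDominoes paving, ∀ e ∈ upDominoes paving, d.SameType e →
    e.WeaklySoutheast d → (e.diag = d.diag + 2 ∨ d.diag = e.diag + 2) →
    SetLE (entry d) (entry e)
  /-- `max(F₁) < min(F₂)` if moreover `F₁` is on `D_{2k}`, `F₂` is on `D_{2(k+1)}` and `max(F₁)` is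
  primed. -/
  southeast_lt_primed : ∀ d ∈ upDominoes paving, ∀ e ∈ upDominoes paving, d.SameType e →
    e.WeaklySoutheast d → e.diag = d.diag + 2 →
    ∀ m, IsGreatest (entry d : Set Letter) m → m.Primed → SetLT (entry d) (entry e)
  /-- `max(F₁) < min(F₂)` if moreover `F₁` is on `D_{2(k+1)}`, `F₂` is on `D_{2k}` and `max(F₁)` is
  unprimed. -/
  southeast_lt_unprimed : ∀ d ∈ upDominoes paving, ∀ e ∈ upDominoes paving, d.SameType e →
    e.WeaklySoutheast d → d.diag = e.diag + 2 →
    ∀ m, IsGreatest (entry d : Set Letter) m → ¬ m.Primed → SetLT (entry d) (entry e)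

namespace ShiftedSVDT

variable {lam : YoungDiagram}

/-- `up(T)`: the dominoes of `T` weakly northeast of `D_0`, each paired with its filling. -/
def up (T : ShiftedSVDT lam) : Finset (Domino × Finset Letter) :=
  (upDominoes T.paving).image fun d => (d, T.entry d)

/-- `T` and `T'` are equivalent if `up(T) = up(T')`. -/
def equivalence (lam : YoungDiagram) : Setoid (ShiftedSVDT lam) := Setoid.ker up

end ShiftedSVDT

/-- The set of shifted set-valued domino tableaux of shape `lam`, up to equivalence. -/
def SVDTClass (lam : YoungDiagram) : Type := Quotient (ShiftedSVDT.equivalence lam)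

namespace SVDTClass

variable {lam : YoungDiagram}

/-- `up(T)`, which depends only on the equivalence class of `T`. -/
def up : SVDTClass lam → Finset (Domino × Finset Letter) :=
  Quotient.lift ShiftedSVDT.up fun _ _ h => h

/-- The exponent vector of the monomial `x^T`. -/
noncomputable def weight (T : SVDTClass lam) : ℕ+ →₀ ℕ := ∑ p ∈ T.up, contentOf p.2

/-- `|up(T)|`, the number of primed and unprimed integers in `up(T)`. -/
def size (T : SVDTClass lam) : ℕ := ∑ p ∈ T.up, p.2.card

/-- `(-1)^{|up(T)| - |up(λ)|}`, where `|up(λ)|` is the number of dominoes of the paving weakly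
northeast of `D_0`; the exponent is a genuine natural number because each of these dominoes
contains at least one letter. -/
def sign (T : SVDTClass lam) : ℤ := (-1) ^ (T.size - T.up.card)

end SVDTClass

end ShiftedDomino

/-!
The proof is a bijection between the classes of shifted set-valued domino tableaux of shape `lam`
and the pairs of shifted set-valued tableaux of shapes `μ` and `ν`, which preserves the monomial
and the number of letters.

A domino meets two neighboring diagonals `D_{m - 1}` and `D_m`; write `hi` for `m`. It has type 1 if
`m` is even and type 2 if `m` is odd. The dominoes with a given value of `hi` are ordered from
northwest to southeast, and `rank` is the position of a domino in this order. The domino with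
`hi = 2 * k` (respectively `2 * k + 1`) and rank `i` corresponds to the box in row `i` on the
diagonal `D_k` of one (respectively the other) component of the 2-quotient. Which component
belongs to which type depends on the parity of the number of parts of `lam`
(`diagCount_eq_of_isTwoQuotient`); the numbers of boxes agree because the diagonal `D_m` of `lam`,
for `m ≥ 0`, has as many boxes as there are boxes of the components that correspond to `m` or to
`m + 1` in this way (`IsProfile`).

*From domino tableaux to pairs.* Counting the boxes on two neighboring diagonals shows that `d` and
`e` with `e.hi = d.hi + 2` satisfy `d.row ≤ e.lowRow` if and only if `rank d ≤ rank e`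
(`IsPaving.row_le_lowRow_iff`). Hence the relation "weakly southeast" between dominoes of the same
type on neighboring even diagonals is the same relation between the corresponding boxes, and the
conditions on the sets of letters turn into those of shifted set-valued tableaux
(`ShiftedSVDT.isDiagTableau_diagEntry`).

*Uniqueness.* A diagonal `D_m` with `m ≥ 0` is met by the dominoes with `hi = m` and `hi = m + 1`,
and the minima of their entries determine in which order they follow each other: for equal minima
the dominoes with `hi = m` come first if the letter is unprimed, and last if it is primed
(`IsShiftedDominoFilling.row_lt_lowRow_iff`). So the ranks and the minima determine the boxes of
a domino on diagonals `D_m` with `m ≥ 0`. Its box on `D_{-1}`, if there is one, is determined by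
the condition on vertical dominoes in a shifted paving, which says that a domino meeting `D_{-1}`
and `D_0` is vertical precisely if all dominoes before it on `D_0` meet `D_{-1}`
(`IsShiftedPaving.lowRow_eq_row_add_one_iff`).

*Existence.* Conversely, a pair of tableaux prescribes the order in which two chains of dominoes
are to be merged along each diagonal `D_m`, `m ≥ 0`. The same is done for `m < 0`, with the letters
on the main diagonals of the two tableaux repeated to the left (`extendOrder`). The semistandard
conditions on the minima say that the two boxes obtained for each domino are adjacent
(`isInterlacing_minOrder`, `upperRow_le_lowerRow`, `lowerRow_le`), and the dominoes form a shifted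
paving (`isPaving_orderPaving`, `no_bad_vertical_orderPaving`) for which the minima are a shifted
domino tableau (`isShiftedDominoFilling_of_orderedBy`).
-/

namespace ShiftedDomino

/-! ### Dominoes and diagonals -/

namespace Domino

/-- The larger of the indices of the two diagonals that the domino meets. -/
def hi (d : Domino) : ℤ := if d.vertical then (d.col : ℤ) - d.row else d.col + 1 - d.row

/-- The row of the box of the domino on the smaller of its two diagonals, `D_{hi - 1}`. The box on
`D_hi` is always in the row `d.row`. -/
def lowRow (d : Domino) : ℕ := if d.vertical then d.row + 1 else d.row

theorem row_le_lowRow (d : Domino) : d.row ≤ d.lowRow := by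
  unfold lowRow; split <;> omega

theorem lowRow_le (d : Domino) : d.lowRow ≤ d.row + 1 := by
  unfold lowRow; split <;> omega

theorem mem_boxes {d : Domino} {r c : ℕ} : (r, c) ∈ d.boxes ↔
    ((c : ℤ) - r = d.hi ∧ r = d.row) ∨ ((c : ℤ) - r = d.hi - 1 ∧ r = d.lowRow) := by
  rcases d with ⟨a, b, v⟩
  cases v <;> simp [boxes, first, second, hi, lowRow, Prod.ext_iff] <;> omega

theorem eq_of_hi_row_lowRow {d e : Domino} (h : d.hi = e.hi) (hr : d.row = e.row)
    (hl : d.lowRow = e.lowRow) : d = e := by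
  rcases d with ⟨a, b, v⟩
  rcases e with ⟨a', b', v'⟩
  cases v <;> cases v' <;> simp [hi, lowRow] at * <;> omega

theorem vertical_iff {d : Domino} : d.vertical = true ↔ d.lowRow = d.row + 1 := by
  rcases d with ⟨a, b, v⟩
  cases v <;> simp [lowRow]

theorem diag_eq (d : Domino) : d.diag = 2 * (d.hi / 2) := by
  rcases d with ⟨a, b, v⟩
  unfold diag
  cases v <;> simp only [boxDiag, first, second, hi, Int.even_iff] <;> split <;> simp at * <;> omega

theorem diag_nonneg_iff {d : Domino} : 0 ≤ d.diag ↔ 0 ≤ d.hi := by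
  rw [diag_eq]; omega

theorem isType1_iff {d : Domino} : d.IsType1 ↔ d.hi % 2 = 0 := by
  unfold IsType1
  rw [diag_eq]
  constructor
  · rintro ⟨⟨r, c⟩, hc, hlt⟩
    rw [mem_boxes] at hc
    simp only [boxDiag] at hlt
    omega
  · intro h
    rcases d with ⟨a, b, v⟩
    cases v
    · refine ⟨(a, b), by simp [boxes, first], ?_⟩
      simp [boxDiag, hi] at *; omega
    · refine ⟨(a + 1, b), by simp [boxes, second], ?_⟩
      simp [boxDiag, hi] at *; omega

theorem weaklySoutheast_iff {d e : Domino} : e.WeaklySoutheast d ↔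
    d.row ≤ e.lowRow ∧ (d.lowRow : ℤ) + d.hi - 1 ≤ e.row + e.hi := by
  rcases d with ⟨a, b, v⟩
  rcases e with ⟨a', b', v'⟩
  unfold WeaklySoutheast
  cases v <;> cases v' <;>
    simp [boxes, first, second, hi, lowRow] <;> omega

end Domino

namespace IsPaving

variable {lam : YoungDiagram} {P : Finset Domino}

theorem exists_mem (hP : IsPaving lam P) {x : ℕ × ℕ} (hx : x ∈ lam) : ∃ d ∈ P, x ∈ d.boxes := by
  have : x ∈ P.biUnion Domino.boxes := by rw [hP.cover]; exact hx
  simpa using this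

theorem mem_of_mem_boxes (hP : IsPaving lam P) {d : Domino} (hd : d ∈ P) {x : ℕ × ℕ}
    (hx : x ∈ d.boxes) : x ∈ lam := by
  have : x ∈ P.biUnion Domino.boxes := Finset.mem_biUnion.2 ⟨d, hd, hx⟩
  rw [hP.cover] at this; exact this

theorem eq_of_mem_boxes (hP : IsPaving lam P) {d e : Domino} (hd : d ∈ P) (he : e ∈ P) {x : ℕ × ℕ}
    (hxd : x ∈ d.boxes) (hxe : x ∈ e.boxes) : d = e := by
  by_contra h
  exact Finset.disjoint_left.1 (hP.disjoint d hd e he h) hxd hxe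

end IsPaving

/-- The number of dominoes of `P` on the same two diagonals as `d` that are northwest of `d`. -/
def rank (P : Finset Domino) (d : Domino) : ℕ :=
  (P.filter fun e => e.hi = d.hi ∧ e.row < d.row).card

theorem mem_upDominoes {P : Finset Domino} {d : Domino} :
    d ∈ upDominoes P ↔ d ∈ P ∧ 0 ≤ d.hi := by
  rw [upDominoes, Finset.mem_filter, Domino.diag_nonneg_iff]

namespace IsPaving

variable {lam : YoungDiagram} {P : Finset Domino}

/-- The box of `d` on the diagonal `D_hi`, for a domino in `upDominoes P`. -/
theorem row_mem_boxes {d : Domino} {m : ℕ} (hm : d.hi = m) : (d.row, d.row + m) ∈ d.boxes := by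
  rw [Domino.mem_boxes]; left; push_cast; omega

theorem lowRow_mem_boxes {d : Domino} {m : ℕ} (hm : d.hi = m + 1) :
    (d.lowRow, d.lowRow + m) ∈ d.boxes := by
  rw [Domino.mem_boxes]; right; push_cast; omega

theorem row_ne_row (hP : IsPaving lam P) {d e : Domino} (hd : d ∈ P) (he : e ∈ P)
    (h0 : 0 ≤ d.hi) (h : d.hi = e.hi) (hr : d.row = e.row) : d = e := by
  obtain ⟨m, hm⟩ := Int.eq_ofNat_of_zero_le h0
  refine hP.eq_of_mem_boxes hd he (row_mem_boxes hm) ?_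
  rw [hr]; exact row_mem_boxes (h ▸ hm)

theorem row_ne_lowRow (hP : IsPaving lam P) {d e : Domino} (hd : d ∈ P) (he : e ∈ P)
    (h0 : 0 ≤ d.hi) (h : e.hi = d.hi + 1) : d.row ≠ e.lowRow := by
  intro hr
  obtain ⟨m, hm⟩ := Int.eq_ofNat_of_zero_le h0
  have : d = e := by
    refine hP.eq_of_mem_boxes hd he (row_mem_boxes hm) ?_
    rw [hr]; exact lowRow_mem_boxes (by omega)
  subst this; omega

theorem lowRow_lt_lowRow (hP : IsPaving lam P) {d e : Domino} (hd : d ∈ P) (he : e ∈ P)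
    (h0 : 1 ≤ d.hi) (h : d.hi = e.hi) : d.lowRow < e.lowRow ↔ d.row < e.row := by
  have h1 := d.row_le_lowRow
  have h2 := d.lowRow_le
  have h3 := e.row_le_lowRow
  have h4 := e.lowRow_le
  have key : d.lowRow = e.lowRow → d = e := by
    intro hr
    obtain ⟨m, hm⟩ := Int.eq_ofNat_of_zero_le (show 0 ≤ d.hi - 1 by omega)
    refine hP.eq_of_mem_boxes hd he (lowRow_mem_boxes (m := m) (by omega)) ?_
    rw [hr]; exact lowRow_mem_boxes (by omega)
  constructor
  · intro hlt
    by_contra hge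
    have : d.row = e.row := by omega
    have := hP.row_ne_row hd he (by omega) h this
    subst this; omega
  · intro hlt
    by_contra hge
    have := key (by omega)
    subst this; omega

/-- The boxes of a diagonal `D_m`, `m ≥ 0`, are the boxes on `D_m` of the dominoes with `hi = m`
or `hi = m + 1`. -/
theorem card_add_card (hP : IsPaving lam P) {m r : ℕ} (hr : ∀ r' < r, (r', r' + m) ∈ lam) :
    (P.filter fun e => e.hi = (m : ℤ) ∧ e.row < r).card +
      (P.filter fun e => e.hi = (m : ℤ) + 1 ∧ e.lowRow < r).card = r := by
  classical
  rw [← Finset.card_union_of_disjoint, ← Finset.filter_or]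
  · conv_rhs => rw [← Finset.card_range r]
    refine Finset.card_bij (fun e _ => if e.hi = m then e.row else e.lowRow) ?_ ?_ ?_
    · intro e he
      rw [Finset.mem_filter] at he
      rw [Finset.mem_range]
      split <;> omega
    · intro d hd e he hde
      rw [Finset.mem_filter] at hd he
      have key : ∀ f ∈ P, (f.hi = m ∧ f.row < r ∨ f.hi = m + 1 ∧ f.lowRow < r) →
          ((if f.hi = m then f.row else f.lowRow), (if f.hi = m then f.row else f.lowRow) + m)
            ∈ f.boxes := by
        rintro f - (h | h)
        · rw [if_pos h.1]; exact row_mem_boxes h.1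
        · rw [if_neg (by omega)]; exact lowRow_mem_boxes h.1
      refine hP.eq_of_mem_boxes hd.1 he.1 (key d hd.1 hd.2) ?_
      have := key e he.1 he.2
      rw [← hde] at this
      exact this
    · intro s hs
      rw [Finset.mem_range] at hs
      obtain ⟨d, hd, hx⟩ := hP.exists_mem (hr s hs)
      refine ⟨d, ?_, ?_⟩
      · rw [Finset.mem_filter]
        rw [Domino.mem_boxes] at hx
        push_cast at hx
        refine ⟨hd, ?_⟩
        omega
      · rw [Domino.mem_boxes] at hx
        push_cast at hx
        split <;> omega
  · rw [Finset.disjoint_filter]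
    intros; omega

theorem diag_left_mem {r r' c m : ℕ} (h : (r, c) ∈ lam) (hr : r' ≤ r) (hc : r' + m ≤ c) :
    (r', r' + m) ∈ lam :=
  lam.up_left_mem hr hc h

/-- If `d` has rank `i` among the dominoes with `hi = m + 2`, then exactly the dominoes with
`hi = m` of rank at most `i` have their upper box weakly above the lower box of `d`: this is what
makes ranks behave like the row index of a tableau of the 2-quotient. -/
theorem card_row_le_lowRow (hP : IsPaving lam P) {d : Domino} (hd : d ∈ P) {m : ℕ}
    (hm : d.hi = m + 2) :
    (P.filter fun e => e.hi = (m : ℤ) ∧ e.row ≤ d.lowRow).card = rank P d + 1 := by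
  have hbox : (d.lowRow, d.lowRow + (m + 1)) ∈ lam :=
    hP.mem_of_mem_boxes hd (lowRow_mem_boxes (by push_cast; omega))
  have h1 := hP.card_add_card (m := m) (r := d.lowRow + 1)
    (fun r' hr' => diag_left_mem hbox (by omega) (by omega))
  have h2 := hP.card_add_card (m := m + 1) (r := d.lowRow)
    (fun r' hr' => diag_left_mem hbox (by omega) (by omega))
  have e1 : (P.filter fun e => e.hi = ((m + 1 : ℕ) : ℤ) ∧ e.row < d.lowRow) =
      P.filter fun e => e.hi = (m : ℤ) + 1 ∧ e.lowRow < d.lowRow + 1 := by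
    refine Finset.filter_congr fun e he => ?_
    push_cast
    refine and_congr_right fun hhi => ?_
    have h3 := e.row_le_lowRow
    have h4 := e.lowRow_le
    have := hP.row_ne_lowRow he hd (by omega) (by omega)
    omega
  have e2 : (P.filter fun e => e.hi = ((m + 1 : ℕ) : ℤ) + 1 ∧ e.lowRow < d.lowRow) =
      P.filter fun e => e.hi = d.hi ∧ e.row < d.row := by
    refine Finset.filter_congr fun e he => ?_
    push_cast
    constructor
    · rintro ⟨a, b⟩
      exact ⟨by omega, (hP.lowRow_lt_lowRow he hd (by omega) (by omega)).1 b⟩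
    · rintro ⟨a, b⟩
      exact ⟨by omega, (hP.lowRow_lt_lowRow he hd (by omega) (by omega)).2 b⟩
  have e3 : (P.filter fun e => e.hi = (m : ℤ) ∧ e.row ≤ d.lowRow) =
      P.filter fun e => e.hi = (m : ℤ) ∧ e.row < d.lowRow + 1 :=
    Finset.filter_congr fun e _ => by omega
  rw [e1, e2] at h2
  rw [e3, rank]
  omega

theorem rank_lt_rank (hP : IsPaving lam P) {d e : Domino} (hd : d ∈ P) (he : e ∈ P)
    (h0 : 0 ≤ d.hi) (h : d.hi = e.hi) : rank P d < rank P e ↔ d.row < e.row := by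
  have key : ∀ {d e : Domino}, d ∈ P → d.hi = e.hi → d.row < e.row → rank P d < rank P e := by
    intro d e hd h hlt
    refine Finset.card_lt_card (Finset.ssubset_iff_of_subset ?_ |>.2 ⟨d, ?_, ?_⟩)
    · intro f
      simp only [Finset.mem_filter]
      rintro ⟨a, b, c⟩
      exact ⟨a, by omega, by omega⟩
    · simp [hd, h, hlt]
    · simp
  refine ⟨fun hlt => ?_, key hd h⟩
  by_contra hge
  rcases (not_lt.1 hge).lt_or_eq with h1 | h1
  · exact absurd (key he h.symm h1) (by omega)
  · have := hP.row_ne_row hd he h0 h h1.symm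
    subst this; omega

theorem eq_of_rank_eq (hP : IsPaving lam P) {d e : Domino} (hd : d ∈ P) (he : e ∈ P)
    (h0 : 0 ≤ d.hi) (h : d.hi = e.hi) (hr : rank P d = rank P e) : d = e := by
  have h1 := hP.rank_lt_rank hd he h0 h
  have h2 := hP.rank_lt_rank he hd (by omega) h.symm
  exact hP.row_ne_row hd he h0 h (by omega)

theorem row_le_lowRow_iff (hP : IsPaving lam P) {d e : Domino} (hd : d ∈ P) (he : e ∈ P)
    (h0 : 0 ≤ d.hi) (h : e.hi = d.hi + 2) : d.row ≤ e.lowRow ↔ rank P d ≤ rank P e := by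
  obtain ⟨m, hm⟩ := Int.eq_ofNat_of_zero_le h0
  have hc := hP.card_row_le_lowRow he (m := m) (by omega)
  rw [← Nat.lt_succ_iff (m := rank P d), Nat.succ_eq_add_one, ← hc]
  constructor
  · intro hle
    refine Finset.card_lt_card (Finset.ssubset_iff_of_subset ?_ |>.2 ⟨d, ?_, ?_⟩)
    · intro f
      simp only [Finset.mem_filter]
      rintro ⟨a, b, c⟩
      exact ⟨a, by omega, by omega⟩
    · simp only [Finset.mem_filter]; exact ⟨hd, hm, hle⟩
    · simp
  · intro hlt
    by_contra hgt
    refine absurd (Finset.card_le_card ?_) (not_le.2 hlt)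
    intro f
    simp only [Finset.mem_filter]
    rintro ⟨a, b, c⟩
    exact ⟨a, by omega, by omega⟩

/-- Relative position of dominoes of the same type on neighboring even diagonals, in terms of
ranks: this matches the position of the corresponding boxes of the 2-quotient. -/
theorem weaklySoutheast_right_iff (hP : IsPaving lam P) {d e : Domino} (hd : d ∈ P) (he : e ∈ P)
    (h0 : 0 ≤ d.hi) (h : e.hi = d.hi + 2) : e.WeaklySoutheast d ↔ rank P d ≤ rank P e := by
  rw [← hP.row_le_lowRow_iff hd he h0 h, Domino.weaklySoutheast_iff]
  have h1 := d.lowRow_le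
  have h2 := e.lowRow_le
  omega

theorem weaklySoutheast_down_iff (hP : IsPaving lam P) {d e : Domino} (hd : d ∈ P) (he : e ∈ P)
    (h0 : 0 ≤ e.hi) (h : d.hi = e.hi + 2) : e.WeaklySoutheast d ↔ rank P d < rank P e := by
  rw [← not_le, ← hP.row_le_lowRow_iff he hd h0 h, Domino.weaklySoutheast_iff]
  have h1 := d.row_le_lowRow
  have h2 := e.row_le_lowRow
  omega

/-- The position of a domino on the larger of its diagonals. -/
theorem row_eq (hP : IsPaving lam P) {d : Domino} (hd : d ∈ P) (h0 : 0 ≤ d.hi) :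
    d.row = rank P d + (P.filter fun e => e.hi = d.hi + 1 ∧ ¬ d.row < e.lowRow).card := by
  obtain ⟨m, hm⟩ := Int.eq_ofNat_of_zero_le h0
  have hbox := hP.mem_of_mem_boxes hd (row_mem_boxes hm)
  have h1 := hP.card_add_card (m := m) (r := d.row)
    (fun r' hr' => diag_left_mem hbox (by omega) (by omega))
  conv_lhs => rw [← h1]
  rw [rank]
  congr 2
  · exact Finset.filter_congr fun e he => by omega
  · refine Finset.filter_congr fun e he => ?_
    constructor
    · rintro ⟨a, b⟩; exact ⟨by omega, by omega⟩
    · rintro ⟨a, b⟩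
      have := hP.row_ne_lowRow hd he h0 (by omega)
      exact ⟨by omega, by omega⟩

/-- The position of a domino on the smaller of its diagonals. -/
theorem lowRow_eq (hP : IsPaving lam P) {d : Domino} (hd : d ∈ P) (h0 : 1 ≤ d.hi) :
    d.lowRow = rank P d + (P.filter fun e => e.hi = d.hi - 1 ∧ e.row < d.lowRow).card := by
  obtain ⟨m, hm⟩ := Int.eq_ofNat_of_zero_le (show 0 ≤ d.hi - 1 by omega)
  have hbox := hP.mem_of_mem_boxes hd (lowRow_mem_boxes (m := m) (by omega))
  have h1 := hP.card_add_card (m := m) (r := d.lowRow)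
    (fun r' hr' => diag_left_mem hbox (by omega) (by omega))
  conv_lhs => rw [← h1]
  rw [rank, add_comm]
  congr 2
  · refine Finset.filter_congr fun e he => ?_
    constructor
    · rintro ⟨a, b⟩
      exact ⟨by omega, (hP.lowRow_lt_lowRow he hd (by omega) (by omega)).1 b⟩
    · rintro ⟨a, b⟩
      exact ⟨by omega, (hP.lowRow_lt_lowRow he hd (by omega) (by omega)).2 b⟩
  · exact Finset.filter_congr fun e he => by omega

end IsPaving

/-! ### Orders along the diagonals determine a shifted paving -/

/-- `h` describes the diagonals of `lam` and of its 2-quotient: `h (2 * k)` and `h (2 * k + 1)` are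
the numbers of rows of the two components that reach beyond the diagonal `D_k`, including the rows
`i < -k`, which start to the right of `D_k`; the same count for the diagonal `D_m` of `lam` is
`h m + h (m + 1)`. The field `low` says that below the main diagonal the components have no boxes
other than those to the left of a box on the main diagonal. -/
structure IsProfile (lam : YoungDiagram) (h : ℤ → ℕ) : Prop where
  mem_iff : ∀ r c : ℕ, (r, c) ∈ lam ↔ r < h ((c : ℤ) - r) + h ((c : ℤ) - r + 1)
  anti : ∀ s, h (s + 2) ≤ h s
  step : ∀ s, h s ≤ h (s + 2) + 1
  low : ∀ s ≤ 1, h s = max (h (s % 2)) (-(s / 2)).toNat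
  eventually_zero : ∃ M : ℕ, ∀ s : ℕ, M ≤ s → h s = 0

/-- The relation `B` describes the order of the dominoes of `P` along each diagonal `D_m`, `m ≥ 0`:
the domino of rank `i` with `hi = m` precedes the domino of rank `j` with `hi = m + 1` if and only
if `B m i j`. -/
def OrderedBy (P : Finset Domino) (B : ℤ → ℕ → ℕ → Prop) : Prop :=
  ∀ d ∈ P, ∀ e ∈ P, 0 ≤ d.hi → e.hi = d.hi + 1 →
    (d.row < e.lowRow ↔ B d.hi (rank P d) (rank P e))

namespace IsPaving

variable {lam : YoungDiagram} {P : Finset Domino} {h : ℤ → ℕ}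

theorem card_hi_eq (hP : IsPaving lam P) (hh : IsProfile lam h) (m : ℕ) :
    (P.filter fun e => e.hi = (m : ℤ)).card = h m := by
  have key : ∀ m : ℕ, (P.filter fun e => e.hi = (m : ℤ)).card +
      (P.filter fun e => e.hi = ((m + 1 : ℕ) : ℤ)).card = h m + h (m + 1) := by
    intro m
    have mem : ∀ r, (r, r + m) ∈ lam ↔ r < h m + h (m + 1) := by
      intro r
      rw [hh.mem_iff, show ((r + m : ℕ) : ℤ) - r = m by push_cast; ring]
    have := hP.card_add_card (m := m) (r := h m + h (m + 1)) fun r' hr' => (mem r').2 hr'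
    rw [← this]
    congr 2
    · refine Finset.filter_congr fun e he => ?_
      refine ⟨fun a => ⟨a, ?_⟩, fun a => a.1⟩
      exact (mem _).1 (hP.mem_of_mem_boxes he (row_mem_boxes a))
    · refine Finset.filter_congr fun e he => ?_
      push_cast
      refine ⟨fun a => ⟨a, ?_⟩, fun a => a.1⟩
      exact (mem _).1 (hP.mem_of_mem_boxes he (lowRow_mem_boxes a))
  obtain ⟨M, hM⟩ := hh.eventually_zero
  have main : ∀ k m : ℕ, M ≤ m + k →
      (P.filter fun e => e.hi = (m : ℤ)).card = h m := by
    intro k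
    induction k with
    | zero =>
      intro m hm
      have h1 := key m
      have h2 := hM m hm
      have h3 := hM (m + 1) (by omega)
      push_cast at h1 h3
      omega
    | succ k ih =>
      intro m hm
      have h1 := key m
      have h2 := ih (m + 1) (by omega)
      push_cast at h1 h2
      omega
  exact main M m (by omega)

theorem rank_lt (hP : IsPaving lam P) (hh : IsProfile lam h) {d : Domino} (hd : d ∈ P)
    (h0 : 0 ≤ d.hi) : rank P d < h d.hi := by
  obtain ⟨m, hm⟩ := Int.eq_ofNat_of_zero_le h0
  rw [hm, ← hP.card_hi_eq hh]
  refine Finset.card_lt_card (Finset.ssubset_iff_of_subset ?_ |>.2 ⟨d, ?_, ?_⟩)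
  · intro f
    simp only [Finset.mem_filter]
    rintro ⟨a, b, c⟩
    exact ⟨a, by omega⟩
  · simp only [Finset.mem_filter]; exact ⟨hd, hm⟩
  · simp

/-- Counting dominoes with a given value of `hi` amounts to counting ranks. -/
theorem card_filter_rank (hP : IsPaving lam P) (hh : IsProfile lam h) {s : ℤ} (hs : 0 ≤ s)
    (Q : ℕ → Prop) [DecidablePred Q] :
    (P.filter fun e => e.hi = s ∧ Q (rank P e)).card = ((Finset.range (h s)).filter Q).card := by
  obtain ⟨m, rfl⟩ := Int.eq_ofNat_of_zero_le hs
  have himg : (P.filter fun e => e.hi = (m : ℤ)).image (rank P) = Finset.range (h m) := by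
    refine Finset.eq_of_subset_of_card_le ?_ ?_
    · intro i
      simp only [Finset.mem_image, Finset.mem_filter, Finset.mem_range]
      rintro ⟨d, ⟨hd, hm⟩, rfl⟩
      rw [← hm]
      exact hP.rank_lt hh hd (by omega)
    · rw [Finset.card_range, Finset.card_image_of_injOn, hP.card_hi_eq hh]
      intro d hd e he hde
      simp only [Finset.coe_filter, Set.mem_ofPred_eq] at hd he
      exact hP.eq_of_rank_eq hd.1 he.1 (by omega) (by omega) hde
  rw [← himg, Finset.filter_image, Finset.card_image_of_injOn, Finset.filter_filter]
  intro d hd e he hde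
  simp only [Finset.coe_filter, Set.mem_ofPred_eq, Finset.mem_filter] at hd he
  exact hP.eq_of_rank_eq hd.1.1 he.1.1 (by omega) (by omega) hde

theorem exists_rank (hP : IsPaving lam P) (hh : IsProfile lam h) {s : ℤ} (hs : 0 ≤ s) {i : ℕ}
    (hi : i < h s) : ∃ d ∈ P, d.hi = s ∧ rank P d = i := by
  have := hP.card_filter_rank hh hs (fun j => j = i)
  rw [Finset.filter_eq', if_pos (Finset.mem_range.2 hi), Finset.card_singleton,
    Finset.card_eq_one] at this
  obtain ⟨d, hd⟩ := this
  have : d ∈ P.filter fun e => e.hi = s ∧ rank P e = i := by rw [hd]; simp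
  rw [Finset.mem_filter] at this
  exact ⟨d, this.1, this.2⟩

open Classical in
theorem row_eq_of_orderedBy (hP : IsPaving lam P) (hh : IsProfile lam h) {B : ℤ → ℕ → ℕ → Prop}
    (hB : OrderedBy P B) {d : Domino} (hd : d ∈ P) (h0 : 0 ≤ d.hi) :
    d.row = rank P d +
      ((Finset.range (h (d.hi + 1))).filter fun j => ¬ B d.hi (rank P d) j).card := by
  rw [← hP.card_filter_rank hh (by omega)]
  conv_lhs => rw [hP.row_eq hd h0]
  congr 2
  refine Finset.filter_congr fun e he => and_congr_right fun hhi => ?_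
  rw [hB d hd e he h0 hhi]

open Classical in
theorem lowRow_eq_of_orderedBy (hP : IsPaving lam P) (hh : IsProfile lam h)
    {B : ℤ → ℕ → ℕ → Prop} (hB : OrderedBy P B) {d : Domino} (hd : d ∈ P) (h0 : 1 ≤ d.hi) :
    d.lowRow = rank P d +
      ((Finset.range (h (d.hi - 1))).filter fun j => B (d.hi - 1) j (rank P d)).card := by
  rw [← hP.card_filter_rank hh (by omega)]
  conv_lhs => rw [hP.lowRow_eq hd h0]
  congr 2
  refine Finset.filter_congr fun e he => and_congr_right fun hhi => ?_
  rw [hB e he d hd (by omega) (by omega), hhi]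

end IsPaving

namespace IsShiftedPaving

variable {lam : YoungDiagram} {P : Finset Domino}

/-- In a shifted paving, the orientation of a domino on the diagonals `D_{-1}`, `D_0` is forced: it
is vertical precisely if all the dominoes that precede it on `D_0` also meet `D_{-1}`. -/
theorem lowRow_eq_row_add_one_iff (hP : IsShiftedPaving lam P) {d : Domino} (hd : d ∈ P)
    (h0 : d.hi = 0) : d.lowRow = d.row + 1 ↔ d.row = rank P d := by
  have hp := hP.toIsPaving
  induction hr : d.row generalizing d with
  | zero =>
    have h1 := hp.row_eq hd (by omega)
    have h2 : d.lowRow = d.row + 1 := by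
      rcases d with ⟨a, b, v⟩
      cases v
      · simp [Domino.hi] at h0 hr; omega
      · simp [Domino.lowRow]
    omega
  | succ p ih =>
    have hlow := d.row_le_lowRow
    have hlow' := d.lowRow_le
    have hdbox : (p + 1, p + 1) ∈ d.boxes := by
      rw [Domino.mem_boxes]; omega
    have hdlam := hp.mem_of_mem_boxes hd hdbox
    have hrow := hp.row_eq hd (by omega)
    constructor
    · intro hv
      have hv2 : d.vertical = true := Domino.vertical_iff.2 (by omega)
      have hbox2 : (p + 2, p + 1) ∈ d.boxes := by
        rw [Domino.mem_boxes]; omega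
      -- some domino to the left of `d` lies on `D_0`; it must cover `(p + 1, p)` vertically
      have hex : ∃ e ∈ P, e.DirectlyLeft d ∧ 0 ≤ e.diag := by
        by_contra hcon
        refine hP.no_bad_vertical ⟨d, hd, hv2, by rw [Domino.diag_eq, h0]; rfl, ?_, ?_⟩
        · obtain ⟨e, he, hx⟩ := hp.exists_mem (x := (p + 1, p))
            (lam.up_left_mem le_rfl (by omega) hdlam)
          exact ⟨e, he, (p + 1, p), hx, hdbox⟩
        · intro e he hed
          by_contra hneg
          exact hcon ⟨e, he, hed, not_lt.1 hneg⟩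
      obtain ⟨e, he, ⟨⟨x, y⟩, hxe, hxd⟩, hdiag⟩ := hex
      rw [Domino.diag_nonneg_iff] at hdiag
      have hne : e ≠ d := by
        rintro rfl
        rw [Domino.mem_boxes] at hxe hxd
        push_cast at hxe hxd
        omega
      have hne2 : e.row ≠ p + 1 := by
        intro hc
        rw [Domino.mem_boxes] at hxe hxd
        push_cast at hxe hxd
        exact hne (hp.row_ne_row he hd hdiag (by omega) (by omega))
      have hel := e.lowRow_le
      have hel' := e.row_le_lowRow
      rw [Domino.mem_boxes] at hxe hxd
      push_cast at hxe hxd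
      have h1 := (ih (d := e) he (by omega) (by omega)).1 (by omega)
      have h2 := (hp.rank_lt_rank he hd (by omega) (by omega)).2 (by omega)
      omega
    · intro hrank
      obtain ⟨f, hf, hx⟩ := hp.exists_mem (x := (p, p))
        (lam.up_left_mem (by omega) (by omega) hdlam)
      rw [Domino.mem_boxes] at hx
      have hempty : (P.filter fun e => e.hi = d.hi + 1 ∧ ¬ d.row < e.lowRow) = ∅ := by
        rw [← Finset.card_eq_zero]; omega
      have hnot : ∀ e ∈ P, e.hi = d.hi + 1 → d.row < e.lowRow := by
        intro e he hhi
        by_contra hcon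
        have : e ∈ (∅ : Finset Domino) := by rw [← hempty, Finset.mem_filter]; exact ⟨he, hhi, hcon⟩
        simp at this
      have hf0 : f.hi = 0 ∧ f.row = p := by
        rcases hx with hx | hx
        · omega
        · have := hnot f hf (by omega); omega
      have hfrow := hp.row_eq hf (by omega)
      have hfempty : (P.filter fun e => e.hi = f.hi + 1 ∧ ¬ f.row < e.lowRow) = ∅ := by
        rw [Finset.filter_eq_empty_iff]
        rintro e he ⟨a, b⟩
        have := hnot e he (by omega)
        omega
      rw [hfempty, Finset.card_empty] at hfrow
      have hfv := (ih hf hf0.1 hf0.2).2 (by omega)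
      by_contra hcon
      have hlr : d.lowRow = p + 1 := by omega
      have : d = f := hp.eq_of_mem_boxes hd hf (x := (p + 1, p))
        (by rw [Domino.mem_boxes]; push_cast; omega) (by rw [Domino.mem_boxes]; push_cast; omega)
      subst this; omega

/-- A shifted paving is determined, weakly northeast of `D_0`, by the order of its dominoes along
the diagonals. -/
theorem eq_of_orderedBy {h : ℤ → ℕ} (hh : IsProfile lam h) {P' : Finset Domino}
    (hP : IsShiftedPaving lam P) (hP' : IsShiftedPaving lam P') {B : ℤ → ℕ → ℕ → Prop}
    (hB : OrderedBy P B) (hB' : OrderedBy P' B) {d d' : Domino} (hd : d ∈ P) (hd' : d' ∈ P')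
    (h0 : 0 ≤ d.hi) (hhi : d.hi = d'.hi) (hr : rank P d = rank P' d') : d = d' := by
  have hrow : d.row = d'.row := by
    rw [hP.row_eq_of_orderedBy hh hB hd h0, hP'.row_eq_of_orderedBy hh hB' hd' (by omega), hhi, hr]
  refine Domino.eq_of_hi_row_lowRow hhi hrow ?_
  rcases h0.lt_or_eq with h1 | h1
  · rw [hP.lowRow_eq_of_orderedBy hh hB hd (by omega),
      hP'.lowRow_eq_of_orderedBy hh hB' hd' (by omega), hhi, hr]
  · have e1 := hP.lowRow_eq_row_add_one_iff hd h1.symm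
    have e2 := hP'.lowRow_eq_row_add_one_iff hd' (by omega)
    have := d.row_le_lowRow
    have := d.lowRow_le
    have := d'.row_le_lowRow
    have := d'.lowRow_le
    omega

end IsShiftedPaving

/-! ### Merging two chains -/

section Merge

open Classical in
/-- The position of the `i`-th element of a first chain in the merge of two chains, the second one
with `b` elements, where `B i j` says that the `i`-th element of the first chain precedes the
`j`-th element of the second one. -/
noncomputable def mergeLeft (b : ℕ) (B : ℕ → ℕ → Prop) (i : ℕ) : ℕ :=
  i + ((Finset.range b).filter fun j => ¬ B i j).card

open Classical in
/-- The position of the `j`-th element of the second chain in the merge of two chains, the first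
one with `a` elements. -/
noncomputable def mergeRight (a : ℕ) (B : ℕ → ℕ → Prop) (j : ℕ) : ℕ :=
  j + ((Finset.range a).filter fun i => B i j).card

/-- The relation `B`, "precedes", between chains of `a` and `b` elements, is compatible with the
order of the chains. -/
structure IsMergeOrder (a b : ℕ) (B : ℕ → ℕ → Prop) : Prop where
  anti_left : ∀ i i' j, i < i' → i' < a → j < b → B i' j → B i j
  mono_right : ∀ i j j', j < j' → j' < b → i < a → B i j → B i j'

variable {a b : ℕ} {B : ℕ → ℕ → Prop}

namespace IsMergeOrder

theorem mergeLeft_lt_mergeLeft (hB : IsMergeOrder a b B) {i i' : ℕ} (h : i < i') (hi' : i' < a) :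
    mergeLeft b B i < mergeLeft b B i' := by
  classical
  refine add_lt_add_of_lt_of_le h (Finset.card_le_card fun j => ?_)
  simp only [Finset.mem_filter, Finset.mem_range]
  exact fun hj => ⟨hj.1, fun hb => hj.2 (hB.anti_left i i' j h hi' hj.1 hb)⟩

theorem mergeRight_lt_mergeRight (hB : IsMergeOrder a b B) {j j' : ℕ} (h : j < j') (hj' : j' < b) :
    mergeRight a B j < mergeRight a B j' := by
  classical
  refine add_lt_add_of_lt_of_le h (Finset.card_le_card fun i => ?_)
  simp only [Finset.mem_filter, Finset.mem_range]
  exact fun hi => ⟨hi.1, hB.mono_right i j j' h hj' hi.1 hi.2⟩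

theorem mergeLeft_lt_mergeRight (hB : IsMergeOrder a b B) {i j : ℕ} (hi : i < a) (hj : j < b)
    (h : B i j) : mergeLeft b B i < mergeRight a B j := by
  classical
  have h1 : ((Finset.range b).filter fun j => ¬ B i j).card ≤ (Finset.range j).card := by
    refine Finset.card_le_card fun k => ?_
    simp only [Finset.mem_filter, Finset.mem_range]
    rintro ⟨hk, hb⟩
    by_contra hlt
    rcases (not_lt.1 hlt).lt_or_eq with h2 | rfl
    · exact hb (hB.mono_right i j k h2 hk hi h)
    · exact hb h
  have h2 : (Finset.range (i + 1)).card ≤ ((Finset.range a).filter fun i => B i j).card := by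
    refine Finset.card_le_card fun k => ?_
    simp only [Finset.mem_filter, Finset.mem_range]
    intro hk
    refine ⟨by omega, ?_⟩
    rcases (Nat.lt_succ_iff.1 hk).lt_or_eq with h2 | rfl
    · exact hB.anti_left k i j h2 hi hj h
    · exact h
  rw [Finset.card_range] at h1 h2
  unfold mergeLeft mergeRight
  omega

theorem mergeRight_lt_mergeLeft (hB : IsMergeOrder a b B) {i j : ℕ} (hi : i < a) (hj : j < b)
    (h : ¬ B i j) : mergeRight a B j < mergeLeft b B i := by
  classical
  have h1 : (Finset.range (j + 1)).card ≤ ((Finset.range b).filter fun j => ¬ B i j).card := by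
    refine Finset.card_le_card fun k => ?_
    simp only [Finset.mem_filter, Finset.mem_range]
    intro hk
    refine ⟨by omega, fun hb => h ?_⟩
    rcases (Nat.lt_succ_iff.1 hk).lt_or_eq with h2 | rfl
    · exact hB.mono_right i k j h2 hj hi hb
    · exact hb
  have h2 : ((Finset.range a).filter fun i => B i j).card ≤ (Finset.range i).card := by
    refine Finset.card_le_card fun k => ?_
    simp only [Finset.mem_filter, Finset.mem_range]
    rintro ⟨hk, hb⟩
    by_contra hlt
    rcases (not_lt.1 hlt).lt_or_eq with h2 | rfl
    · exact h (hB.anti_left i k j h2 hk hj hb)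
    · exact h hb
  rw [Finset.card_range] at h1 h2
  unfold mergeLeft mergeRight
  omega

theorem mergeLeft_lt_mergeRight_iff (hB : IsMergeOrder a b B) {i j : ℕ} (hi : i < a) (hj : j < b) :
    mergeLeft b B i < mergeRight a B j ↔ B i j := by
  refine ⟨fun h => ?_, hB.mergeLeft_lt_mergeRight hi hj⟩
  by_contra hb
  exact absurd (hB.mergeRight_lt_mergeLeft hi hj hb) (by omega)

theorem mergeLeft_ne_mergeRight (hB : IsMergeOrder a b B) {i j : ℕ} (hi : i < a) (hj : j < b) :
    mergeLeft b B i ≠ mergeRight a B j := by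
  by_cases hb : B i j
  · exact (hB.mergeLeft_lt_mergeRight hi hj hb).ne
  · exact (hB.mergeRight_lt_mergeLeft hi hj hb).ne'

theorem mergeLeft_injective (hB : IsMergeOrder a b B) {i i' : ℕ} (hi : i < a) (hi' : i' < a)
    (h : mergeLeft b B i = mergeLeft b B i') : i = i' := by
  rcases lt_trichotomy i i' with h1 | h1 | h1
  · exact absurd h (hB.mergeLeft_lt_mergeLeft h1 hi').ne
  · exact h1
  · exact absurd h (hB.mergeLeft_lt_mergeLeft h1 hi).ne'

theorem mergeRight_injective (hB : IsMergeOrder a b B) {j j' : ℕ} (hj : j < b) (hj' : j' < b)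
    (h : mergeRight a B j = mergeRight a B j') : j = j' := by
  rcases lt_trichotomy j j' with h1 | h1 | h1
  · exact absurd h (hB.mergeRight_lt_mergeRight h1 hj').ne
  · exact h1
  · exact absurd h (hB.mergeRight_lt_mergeRight h1 hj).ne'

end IsMergeOrder

theorem mergeLeft_lt {i : ℕ} (hi : i < a) : mergeLeft b B i < a + b := by
  classical
  have := Finset.card_filter_le (Finset.range b) fun j => ¬ B i j
  rw [Finset.card_range] at this
  unfold mergeLeft
  omega

theorem mergeRight_lt {j : ℕ} (hj : j < b) : mergeRight a B j < a + b := by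
  classical
  have := Finset.card_filter_le (Finset.range a) fun i => B i j
  rw [Finset.card_range] at this
  unfold mergeRight
  omega

theorem IsMergeOrder.exists_eq (hB : IsMergeOrder a b B) {r : ℕ} (hr : r < a + b) :
    (∃ i < a, mergeLeft b B i = r) ∨ ∃ j < b, mergeRight a B j = r := by
  classical
  have h1 : (Finset.range a).image (mergeLeft b B) ∪ (Finset.range b).image (mergeRight a B) =
      Finset.range (a + b) := by
    refine Finset.eq_of_subset_of_card_le ?_ ?_
    · intro r
      simp only [Finset.mem_union, Finset.mem_image, Finset.mem_range]
      rintro (⟨i, hi, rfl⟩ | ⟨j, hj, rfl⟩)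
      · exact mergeLeft_lt hi
      · exact mergeRight_lt hj
    · rw [Finset.card_union_of_disjoint, Finset.card_image_of_injOn, Finset.card_image_of_injOn]
      · simp
      · intro j hj j' hj' h
        simp only [Finset.coe_range, Set.mem_Iio] at hj hj'
        exact hB.mergeRight_injective hj hj' h
      · intro i hi i' hi' h
        simp only [Finset.coe_range, Set.mem_Iio] at hi hi'
        exact hB.mergeLeft_injective hi hi' h
      · rw [Finset.disjoint_left]
        simp only [Finset.mem_image, Finset.mem_range]
        rintro _ ⟨i, hi, rfl⟩ ⟨j, hj, h⟩
        exact hB.mergeLeft_ne_mergeRight hi hj h.symm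
  have : r ∈ Finset.range (a + b) := Finset.mem_range.2 hr
  rw [← h1] at this
  simpa only [Finset.mem_union, Finset.mem_image, Finset.mem_range] using this

end Merge

/-! ### Construction of a shifted paving with a prescribed order along the diagonals -/

/-- The conditions on the orders `B m` of the dominoes along the diagonals `D_m`, `m ≥ 0`, under
which they come from a shifted paving: `right` and `down` say that the two boxes of each domino
are adjacent. -/
structure IsInterlacing (h : ℤ → ℕ) (B : ℤ → ℕ → ℕ → Prop) : Prop where
  isMergeOrder : ∀ m, 0 ≤ m → IsMergeOrder (h m) (h (m + 1)) (B m)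
  right : ∀ m i j, 0 ≤ m → i < h (m + 1) → j < h (m + 2) → ¬ B (m + 1) i j → B m j i
  down : ∀ m i j, 0 ≤ m → i < h (m + 1) → j + 1 < h m → B m (j + 1) i → ¬ B (m + 1) i j

/-- The extension of the orders `B m` to the diagonals `D_m` with `m < 0`. The rows of the
components that start to the right of the diagonal come first, and the others have the same order
as on `D_0`: this amounts to filling the boxes of the components below the main diagonal with the
letter on the main diagonal in the same row. -/
def extendOrder (B : ℤ → ℕ → ℕ → Prop) (m : ℤ) (i j : ℕ) : Prop :=
  if 0 ≤ m then B m i j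
  else (i : ℤ) < -(m / 2) ∨
    (¬ (j : ℤ) < -((m + 1) / 2) ∧ if m % 2 = 0 then B 0 i j else ¬ B 0 j i)

section Construction

variable {lam : YoungDiagram} {h : ℤ → ℕ} {B : ℤ → ℕ → ℕ → Prop}

theorem IsProfile.lt_of_even (hh : IsProfile lam h) {s : ℤ} (hs : s ≤ 1) (hpar : s % 2 = 0)
    {i : ℕ} (hi : i < h s) (hreal : -(s / 2) ≤ i) : i < h 0 := by
  have := hh.low s hs
  rw [hpar] at this
  omega

theorem IsProfile.lt_of_odd (hh : IsProfile lam h) {s : ℤ} (hs : s ≤ 1) (hpar : s % 2 = 1)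
    {i : ℕ} (hi : i < h s) (hreal : -(s / 2) ≤ i) : i < h 1 := by
  have := hh.low s hs
  rw [hpar] at this
  omega

theorem IsProfile.neg_le (hh : IsProfile lam h) (s : ℤ) : -(s / 2) ≤ h s := by
  rcases le_or_gt s 1 with h1 | h1
  · have := hh.low s h1; omega
  · omega

theorem extendOrder_of_nonneg {m : ℤ} (hm : 0 ≤ m) : extendOrder B m = B m := by
  funext i j
  simp [extendOrder, hm]

theorem isMergeOrder_extendOrder (hh : IsProfile lam h) (hB : IsInterlacing h B) (m : ℤ) :
    IsMergeOrder (h m) (h (m + 1)) (extendOrder B m) := by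
  rcases le_or_gt 0 m with hm | hm
  · rw [extendOrder_of_nonneg hm]; exact hB.isMergeOrder m hm
  have h0 := hB.isMergeOrder 0 le_rfl
  constructor
  · intro i i' j hii hi' hj
    simp only [extendOrder, if_neg (not_le.2 hm)]
    rintro (h1 | ⟨h1, h2⟩)
    · left; omega
    by_cases h3 : (i' : ℤ) < -(m / 2)
    · left; omega
    refine or_iff_not_imp_left.2 fun h4 => ⟨h1, ?_⟩
    split_ifs at h2 ⊢ with hpar
    · exact h0.anti_left i i' j hii (hh.lt_of_even (by omega) hpar hi' (by omega))
        (hh.lt_of_odd (by omega) (by omega) hj (by omega)) h2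
    · exact fun h5 => h2 (h0.mono_right j i i' hii
        (hh.lt_of_odd (by omega) (by omega) hi' (by omega))
        (hh.lt_of_even (by omega) (by omega) hj (by omega)) h5)
  · intro i j j' hjj hj' hi
    simp only [extendOrder, if_neg (not_le.2 hm)]
    rintro (h1 | ⟨h1, h2⟩)
    · left; omega
    refine or_iff_not_imp_left.2 fun h4 => ⟨by omega, ?_⟩
    split_ifs at h2 ⊢ with hpar
    · exact h0.mono_right i j j' hjj (hh.lt_of_odd (by omega) (by omega) hj' (by omega))
        (hh.lt_of_even (by omega) hpar hi (by omega)) h2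
    · exact fun h5 => h2 (h0.anti_left j j' i hjj
        (hh.lt_of_even (by omega) (by omega) hj' (by omega))
        (hh.lt_of_odd (by omega) (by omega) hi (by omega)) h5)

theorem extendOrder_right (hB : IsInterlacing h B) {m : ℤ} {i j : ℕ}
    (hi : i < h (m + 1)) (hreal : -((m + 1) / 2) ≤ i) (hj : j < h (m + 2))
    (hn : ¬ extendOrder B (m + 1) i j) : extendOrder B m j i := by
  rcases le_or_gt 0 m with hm | hm
  · rw [extendOrder_of_nonneg (by omega)] at hn ⊢
    exact hB.right m i j hm hi hj hn
  simp only [extendOrder, if_neg (not_le.2 hm)]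
  refine or_iff_not_imp_left.2 fun h1 => ⟨by omega, ?_⟩
  rcases le_or_gt 0 (m + 1) with hm1 | hm1
  · obtain rfl : m = -1 := by omega
    rw [extendOrder_of_nonneg (by omega)] at hn
    simpa using hn
  · simp only [extendOrder, if_neg (not_le.2 hm1), not_or, not_and] at hn
    have := hn.2 (by omega)
    rcases Int.emod_two_eq_zero_or_one m with h2 | h2
    · rw [if_pos h2]
      rwa [if_neg (by omega), not_not] at this
    · rw [if_neg (by omega)]
      rwa [if_pos (by omega)] at this

theorem extendOrder_down (hh : IsProfile lam h) (hB : IsInterlacing h B) {m : ℤ} {i j : ℕ}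
    (hi : i < h (m + 1)) (hreal : -((m + 1) / 2) ≤ i) (hj : j + 1 < h m)
    (hb : extendOrder B m (j + 1) i) : ¬ extendOrder B (m + 1) i j := by
  rcases le_or_gt 0 m with hm | hm
  · rw [extendOrder_of_nonneg (by omega)] at hb ⊢
    exact hB.down m i j hm hi hj hb
  have h0 := hB.isMergeOrder 0 le_rfl
  simp only [extendOrder, if_neg (not_le.2 hm)] at hb
  rcases le_or_gt 0 (m + 1) with hm1 | hm1
  · obtain rfl : m = -1 := by omega
    rw [extendOrder_of_nonneg (by omega)]
    rcases hb with h1 | ⟨_, h1⟩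
    · push_cast at h1; omega
    · rw [if_neg (by norm_num)] at h1
      exact fun h2 => h1 (h0.mono_right i j (j + 1) (by omega)
        (hh.lt_of_odd (by norm_num) (by norm_num) hj (by push_cast; omega)) (by simpa using hi) h2)
  · simp only [extendOrder, if_neg (not_le.2 hm1), not_or, not_and]
    refine ⟨by omega, fun h1 => ?_⟩
    rcases hb with h2 | ⟨_, h2⟩
    · push_cast at h2; omega
    by_cases h5 : ((j + 1 : ℕ) : ℤ) < -(m / 2)
    · push_cast at h5; omega
    rcases Int.emod_two_eq_zero_or_one m with h3 | h3
    · rw [if_pos h3] at h2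
      rw [if_neg (by omega), not_not]
      exact h0.anti_left j (j + 1) i (by omega) (hh.lt_of_even (by omega) h3 hj (by omega))
        (hh.lt_of_odd (by omega) (by omega) hi (by omega)) h2
    · rw [if_neg (by omega)] at h2
      rw [if_pos (by omega)]
      exact fun h6 => h2 (h0.mono_right i j (j + 1) (by omega)
        (hh.lt_of_odd (by omega) (by omega) hj (by omega))
        (hh.lt_of_even (by omega) (by omega) hi (by omega)) h6)

variable (h B) in
/-- The row, on the diagonal `D_s`, of the domino with `hi = s` and rank `i`. -/
noncomputable def upperRow (s : ℤ) (i : ℕ) : ℕ := mergeLeft (h (s + 1)) (extendOrder B s) i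

variable (h B) in
/-- The row, on the diagonal `D_{s - 1}`, of the domino with `hi = s` and rank `i`. -/
noncomputable def lowerRow (s : ℤ) (i : ℕ) : ℕ :=
  mergeRight (h (s - 1)) (extendOrder B (s - 1)) i

theorem upperRow_le_lowerRow (hh : IsProfile lam h) (hB : IsInterlacing h B) {s : ℤ} {i : ℕ}
    (hi : i < h s) (hreal : -(s / 2) ≤ i) : upperRow h B s i ≤ lowerRow h B s i := by
  classical
  refine Nat.add_le_add_left (Finset.card_le_card fun j => ?_) _
  simp only [Finset.mem_filter, Finset.mem_range]
  rintro ⟨hj, hn⟩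
  obtain ⟨m, rfl⟩ : ∃ m, s = m + 1 := ⟨s - 1, by ring⟩
  have hanti := hh.anti m
  rw [show m + 1 + 1 = m + 2 by ring] at hj
  rw [add_sub_cancel_right]
  exact ⟨by omega, extendOrder_right hB hi hreal hj hn⟩

theorem lowerRow_le (hh : IsProfile lam h) (hB : IsInterlacing h B) {s : ℤ} {i : ℕ}
    (hi : i < h s) (hreal : -(s / 2) ≤ i) : lowerRow h B s i ≤ upperRow h B s i + 1 := by
  classical
  obtain ⟨m, rfl⟩ : ∃ m, s = m + 1 := ⟨s - 1, by ring⟩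
  unfold lowerRow upperRow mergeLeft mergeRight
  rw [add_sub_cancel_right, show m + 1 + 1 = m + 2 by ring, add_assoc]
  refine Nat.add_le_add_left ?_ _
  -- shift the first chain by one and compare
  have hsub : ((Finset.range (h m)).filter fun j => extendOrder B m j i) ⊆
      insert 0 (((Finset.range (h (m + 2))).filter
        fun j => ¬ extendOrder B (m + 1) i j).image Nat.succ) := by
    intro j
    simp only [Finset.mem_filter, Finset.mem_range, Finset.mem_insert, Finset.mem_image]
    rintro ⟨hj, hb⟩
    rcases j with _ | j
    · left; rfl
    · right
      have := hh.step m
      exact ⟨j, ⟨by omega, extendOrder_down hh hB hi hreal hj hb⟩, rfl⟩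
  refine (Finset.card_le_card hsub).trans ((Finset.card_insert_le _ _).trans ?_)
  exact Nat.add_le_add_right Finset.card_image_le _

/-- The rows that start to the right of a diagonal come first, so the other ones lead to boxes in the
quadrant; `upperRow_lt_neg` and `lowerRow_lt_neg` are the converse. -/
theorem neg_le_lowerRow (hh : IsProfile lam h) {s : ℤ} {i : ℕ}
    (hreal : -(s / 2) ≤ i) : -(s - 1) ≤ lowerRow h B s i := by
  classical
  rcases le_or_gt 0 (s - 1) with hs | hs
  · omega
  have hsub : Finset.range (-((s - 1) / 2)).toNat ⊆
      (Finset.range (h (s - 1))).filter fun j => extendOrder B (s - 1) j i := by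
    intro j
    simp only [Finset.mem_filter, Finset.mem_range, extendOrder, if_neg (not_le.2 hs)]
    intro hj
    have := hh.neg_le (s - 1)
    exact ⟨by omega, by omega⟩
  have := Finset.card_le_card hsub
  rw [Finset.card_range] at this
  unfold lowerRow mergeRight
  omega

theorem upperRow_lt_neg {s : ℤ} {i : ℕ} (hph : (i : ℤ) < -(s / 2)) :
    (upperRow h B s i : ℤ) < -s := by
  classical
  have : ((Finset.range (h (s + 1))).filter fun j => ¬ extendOrder B s i j) = ∅ := by
    rw [Finset.filter_eq_empty_iff]
    intro j _
    simp only [extendOrder, if_neg (show ¬ 0 ≤ s by omega)]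
    omega
  unfold upperRow mergeLeft
  rw [this, Finset.card_empty]
  omega

theorem lowerRow_lt_neg {s : ℤ} {i : ℕ} (hph : (i : ℤ) < -(s / 2)) :
    (lowerRow h B s i : ℤ) < -(s - 1) := by
  classical
  have : ((Finset.range (h (s - 1))).filter fun j => extendOrder B (s - 1) j i) ⊆
      Finset.range (-((s - 1) / 2)).toNat := by
    intro j
    simp only [Finset.mem_filter, Finset.mem_range, extendOrder, if_neg (show ¬ 0 ≤ s - 1 by omega)]
    rintro ⟨_, h1 | ⟨h1, _⟩⟩ <;> omega
  have := Finset.card_le_card this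
  rw [Finset.card_range] at this
  unfold lowerRow mergeRight
  omega

variable (h B) in
/-- The domino with `hi = s` and rank `i`. -/
noncomputable def orderDomino (s : ℤ) (i : ℕ) : Domino where
  row := upperRow h B s i
  col := ((lowerRow h B s i : ℤ) + s - 1).toNat
  vertical := decide (lowerRow h B s i = upperRow h B s i + 1)

@[simp]
theorem orderDomino_row (s : ℤ) (i : ℕ) : (orderDomino h B s i).row = upperRow h B s i := rfl

theorem orderDomino_lowRow (hh : IsProfile lam h) (hB : IsInterlacing h B) {s : ℤ} {i : ℕ}
    (hi : i < h s) (hreal : -(s / 2) ≤ i) :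
    (orderDomino h B s i).lowRow = lowerRow h B s i := by
  have h1 := upperRow_le_lowerRow hh hB hi hreal
  have h2 := lowerRow_le hh hB hi hreal
  simp only [Domino.lowRow, orderDomino, decide_eq_true_eq]
  split <;> omega

theorem orderDomino_hi (hh : IsProfile lam h) (hB : IsInterlacing h B) {s : ℤ} {i : ℕ}
    (hi : i < h s) (hreal : -(s / 2) ≤ i) : (orderDomino h B s i).hi = s := by
  have h1 := upperRow_le_lowerRow hh hB hi hreal
  have h2 := lowerRow_le hh hB hi hreal
  have h3 := neg_le_lowerRow (B := B) hh hreal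
  simp only [Domino.hi, orderDomino, decide_eq_true_eq]
  split <;> omega

variable (lam h B) in
open Classical in
/-- The set of the dominoes `orderDomino h B s i`, where `i` is a row of the component that starts
weakly to the left of the diagonal. -/
noncomputable def orderPaving : Finset Domino :=
  ((lam.cells ×ˢ Finset.univ).image fun p : (ℕ × ℕ) × Bool => Domino.mk p.1.1 p.1.2 p.2).filter
    fun d => ∃ s : ℤ, ∃ i : ℕ, i < h s ∧ -(s / 2) ≤ i ∧ orderDomino h B s i = d

theorem mem_lam_of_mem_orderDomino (hh : IsProfile lam h) (hB : IsInterlacing h B) {s : ℤ} {i : ℕ}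
    (hi : i < h s) (hreal : -(s / 2) ≤ i) {x : ℕ × ℕ} (hx : x ∈ (orderDomino h B s i).boxes) :
    x ∈ lam := by
  obtain ⟨r, c⟩ := x
  rw [Domino.mem_boxes, orderDomino_hi hh hB hi hreal, orderDomino_lowRow hh hB hi hreal] at hx
  rw [hh.mem_iff]
  rcases hx with ⟨h1, h2⟩ | ⟨h1, h2⟩
  · rw [h1, h2]; exact mergeLeft_lt hi
  · rw [h1, h2, sub_add_cancel]; exact mergeRight_lt hi

theorem mem_orderPaving (hh : IsProfile lam h) (hB : IsInterlacing h B) {d : Domino} :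
    d ∈ orderPaving lam h B ↔
      ∃ s : ℤ, ∃ i : ℕ, i < h s ∧ -(s / 2) ≤ i ∧ orderDomino h B s i = d := by
  simp only [orderPaving, Finset.mem_filter, and_iff_right_iff_imp]
  rintro ⟨s, i, hi, hreal, rfl⟩
  simp only [Finset.mem_image]
  refine ⟨((orderDomino h B s i).first, (orderDomino h B s i).vertical), ?_, rfl⟩
  rw [Finset.mem_product]
  refine ⟨mem_lam_of_mem_orderDomino hh hB hi hreal ?_, Finset.mem_univ _⟩
  simp [Domino.boxes]

theorem isPaving_orderPaving (hh : IsProfile lam h) (hB : IsInterlacing h B) :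
    IsPaving lam (orderPaving lam h B) where
  disjoint := by
    simp only [mem_orderPaving hh hB]
    rintro _ ⟨s, i, hi, hsi, rfl⟩ _ ⟨t, j, hj, htj, rfl⟩ hne
    rw [Finset.disjoint_left]
    rintro ⟨r, c⟩ h1 h2
    rw [Domino.mem_boxes, orderDomino_hi hh hB hi hsi, orderDomino_lowRow hh hB hi hsi] at h1
    rw [Domino.mem_boxes, orderDomino_hi hh hB hj htj, orderDomino_lowRow hh hB hj htj] at h2
    apply hne
    rcases h1 with ⟨a1, b1⟩ | ⟨a1, b1⟩ <;> rcases h2 with ⟨a2, b2⟩ | ⟨a2, b2⟩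
    · obtain rfl : s = t := by omega
      rw [(isMergeOrder_extendOrder hh hB s).mergeLeft_injective hi hj (b1.symm.trans b2)]
    · obtain rfl : t = s + 1 := by omega
      have := (isMergeOrder_extendOrder hh hB s).mergeLeft_ne_mergeRight hi hj
      rw [lowerRow, add_sub_cancel_right] at b2
      exact absurd (b1.symm.trans b2) this
    · obtain rfl : s = t + 1 := by omega
      have := (isMergeOrder_extendOrder hh hB t).mergeLeft_ne_mergeRight hj hi
      rw [lowerRow, add_sub_cancel_right] at b1
      exact absurd (b2.symm.trans b1) this
    · obtain rfl : s = t := by omega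
      have := isMergeOrder_extendOrder hh hB (s - 1)
      rw [sub_add_cancel] at this
      rw [this.mergeRight_injective hi hj (b1.symm.trans b2)]
  cover := by
    ext ⟨r, c⟩
    simp only [Finset.mem_biUnion, mem_orderPaving hh hB, YoungDiagram.mem_cells]
    constructor
    · rintro ⟨_, ⟨s, i, hi, hsi, rfl⟩, hx⟩
      exact mem_lam_of_mem_orderDomino hh hB hi hsi hx
    · intro hx
      obtain ⟨m, hm⟩ : ∃ m : ℤ, (c : ℤ) - r = m := ⟨_, rfl⟩
      have hr := (hh.mem_iff r c).1 hx
      rw [hm] at hr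
      rcases (isMergeOrder_extendOrder hh hB m).exists_eq hr with ⟨i, hi, hir⟩ | ⟨j, hj, hjr⟩
      · have hreal : -(m / 2) ≤ i := by
          by_contra hcon
          have := upperRow_lt_neg (h := h) (B := B) (not_le.1 hcon)
          unfold upperRow at this
          omega
        refine ⟨_, ⟨m, i, hi, hreal, rfl⟩, ?_⟩
        rw [Domino.mem_boxes, orderDomino_hi hh hB hi hreal]
        exact Or.inl ⟨hm, hir.symm⟩
      · have hreal : -((m + 1) / 2) ≤ j := by
          by_contra hcon
          have := lowerRow_lt_neg (h := h) (B := B) (not_le.1 hcon)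
          unfold lowerRow at this
          rw [add_sub_cancel_right] at this
          omega
        refine ⟨_, ⟨m + 1, j, hj, hreal, rfl⟩, ?_⟩
        rw [Domino.mem_boxes, orderDomino_hi hh hB hj hreal, orderDomino_lowRow hh hB hj hreal,
          lowerRow, add_sub_cancel_right]
        exact Or.inr ⟨hm, hjr.symm⟩

theorem no_bad_vertical_orderPaving (hh : IsProfile lam h) (hB : IsInterlacing h B) :
    ¬ ∃ d ∈ orderPaving lam h B, d.vertical = true ∧ d.diag = 0 ∧
      (∃ e ∈ orderPaving lam h B, e.DirectlyLeft d) ∧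
        ∀ e ∈ orderPaving lam h B, e.DirectlyLeft d → e.diag < 0 := by
  classical
  rintro ⟨d, hd, hv, hdiag, ⟨f, hf, ⟨⟨x, y⟩, hx, hy⟩⟩, hall⟩
  have hP := isPaving_orderPaving hh hB
  rw [Domino.diag_eq] at hdiag
  rw [Domino.vertical_iff] at hv
  rw [Domino.mem_boxes] at hy
  push_cast at hy
  -- it suffices to find a domino to the left of `d` that meets `D_0`
  suffices hs : ∃ e ∈ orderPaving lam h B, e.DirectlyLeft d ∧ 0 ≤ e.hi by
    obtain ⟨e, he, h1, h2⟩ := hs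
    have := hall e he h1
    rw [Domino.diag_eq] at this
    omega
  rcases (show d.hi = 0 ∨ d.hi = 1 by omega) with h0 | h1
  · obtain ⟨s, i, hi, hreal, rfl⟩ := (mem_orderPaving hh hB).1 hd
    rw [orderDomino_hi hh hB hi hreal] at h0
    subst h0
    rw [orderDomino_hi hh hB hi hreal] at hy
    have hlow := hh.low (-1) (by norm_num)
    norm_num at hlow
    rw [orderDomino_lowRow hh hB hi hreal, orderDomino_row] at hv hy
    have hm := hB.isMergeOrder 0 le_rfl
    have hiff : ∀ j k, extendOrder B (-1) j k ↔ (j < 1 ∨ ¬ B 0 k j) := by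
      intro j k
      simp [extendOrder]
    rw [zero_add] at hm
    have hup : ∀ k, upperRow h B 0 k =
        k + ((Finset.range (h 1)).filter fun j => ¬ B 0 k j).card := by
      intro k
      rw [upperRow, mergeLeft, extendOrder_of_nonneg le_rfl, zero_add]
    have hdown : ∀ k, lowerRow h B 0 k =
        k + ((Finset.range (h (-1))).filter fun j => j < 1 ∨ ¬ B 0 k j).card := by
      intro k
      rw [lowerRow, mergeRight, zero_sub]
      simp only [hiff]
    -- since the domino is vertical, only dominoes with `hi = 0` precede it on `D_0`
    have hBi : ∀ j < h 1, B 0 i j := by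
      by_contra hcon
      push Not at hcon
      obtain ⟨j, hj, hnj⟩ := hcon
      have hn0 : ¬ B 0 i 0 := by
        rcases Nat.eq_zero_or_pos j with rfl | hpos
        · exact hnj
        · exact fun h2 => hnj (hm.mono_right i 0 j hpos hj hi h2)
      have : upperRow h B 0 i = lowerRow h B 0 i := by
        rw [hup, hdown, hlow, max_eq_left (by omega)]
        congr 2
        refine Finset.filter_congr fun k _ => ?_
        constructor
        · exact Or.inr
        · rintro (h2 | h2)
          · obtain rfl : k = 0 := by omega
            exact hn0
          · exact h2
      omega
    have hupi : ∀ k ≤ i, upperRow h B 0 k = k := by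
      intro k hk
      rw [hup, Finset.filter_eq_empty_iff.2, Finset.card_empty, add_zero]
      intro j hj
      rw [Finset.mem_range] at hj
      rw [not_not]
      rcases hk.lt_or_eq with h2 | rfl
      · exact hm.anti_left k i j h2 hi hj (hBi j hj)
      · exact hBi j hj
    have hii := hupi i le_rfl
    obtain ⟨k, rfl⟩ : ∃ k, i = k + 1 := ⟨i - 1, by omega⟩
    have hk : k < h 0 := by omega
    have hkk := hupi k (by omega)
    have hdk : k + 1 ≤ lowerRow h B 0 k := by
      rw [hdown]
      refine Nat.add_le_add_left (Finset.card_pos.2 ⟨0, ?_⟩) _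
      simp only [Finset.mem_filter, Finset.mem_range]
      omega
    have hdk2 := lowerRow_le hh hB hk (s := 0) (by simp)
    refine ⟨orderDomino h B 0 k, (mem_orderPaving hh hB).2 ⟨0, k, hk, by simp, rfl⟩,
      ⟨(k + 1, k), ?_, ?_⟩, by rw [orderDomino_hi hh hB hk (by simp)]⟩
    · rw [Domino.mem_boxes, orderDomino_hi hh hB hk (by simp),
        orderDomino_lowRow hh hB hk (by simp)]
      right; push_cast; omega
    · rw [Domino.mem_boxes, orderDomino_hi hh hB hi hreal, orderDomino_row, hii]
      left; push_cast; omega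
  · have hbox : (d.row, d.row + 1) ∈ d.boxes := by
      rw [Domino.mem_boxes]; push_cast; omega
    obtain ⟨e, he, hxe⟩ := hP.exists_mem (x := (d.row, d.row))
      (lam.up_left_mem le_rfl (by omega) (hP.mem_of_mem_boxes hd hbox))
    refine ⟨e, he, ⟨_, hxe, hbox⟩, ?_⟩
    rw [Domino.mem_boxes] at hxe
    omega

theorem rank_orderDomino (hh : IsProfile lam h) (hB : IsInterlacing h B) {s : ℤ} (hs : 0 ≤ s)
    {i : ℕ} (hi : i < h s) : rank (orderPaving lam h B) (orderDomino h B s i) = i := by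
  have hm := isMergeOrder_extendOrder hh hB s
  have hreal : ∀ k : ℕ, -(s / 2) ≤ (k : ℤ) := fun k => by omega
  have : ((orderPaving lam h B).filter fun e =>
      e.hi = (orderDomino h B s i).hi ∧ e.row < (orderDomino h B s i).row) =
      (Finset.range i).image (orderDomino h B s) := by
    ext e
    simp only [Finset.mem_filter, Finset.mem_image, Finset.mem_range, mem_orderPaving hh hB,
      orderDomino_hi hh hB hi (hreal i)]
    constructor
    · rintro ⟨⟨t, j, hj, htj, rfl⟩, h1, h2⟩
      rw [orderDomino_hi hh hB hj htj] at h1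
      subst h1
      refine ⟨j, ?_, rfl⟩
      by_contra hcon
      rcases (not_lt.1 hcon).lt_or_eq with h3 | rfl
      · exact absurd (hm.mergeLeft_lt_mergeLeft h3 hj) (not_lt.2 (le_of_lt h2))
      · exact absurd h2 (lt_irrefl _)
    · rintro ⟨j, hj, rfl⟩
      have hj' : j < h s := hj.trans hi
      exact ⟨⟨s, j, hj', hreal j, rfl⟩, orderDomino_hi hh hB hj' (hreal j),
        hm.mergeLeft_lt_mergeLeft hj hi⟩
  rw [rank, this, Finset.card_image_of_injOn, Finset.card_range]
  intro j hj k hk hjk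
  simp only [Finset.coe_range, Set.mem_Iio] at hj hk
  exact hm.mergeLeft_injective (hj.trans hi) (hk.trans hi) (congrArg Domino.row hjk)

theorem orderedBy_orderPaving (hh : IsProfile lam h) (hB : IsInterlacing h B) :
    OrderedBy (orderPaving lam h B) B := by
  intro d hd e he h0 h1
  obtain ⟨s, i, hi, hsi, rfl⟩ := (mem_orderPaving hh hB).1 hd
  obtain ⟨t, j, hj, htj, rfl⟩ := (mem_orderPaving hh hB).1 he
  rw [orderDomino_hi hh hB hi hsi] at h0 h1 ⊢
  rw [orderDomino_hi hh hB hj htj] at h1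
  subst h1
  rw [rank_orderDomino hh hB h0 hi, rank_orderDomino hh hB (by omega) hj,
    orderDomino_lowRow hh hB hj htj, orderDomino_row, lowerRow, add_sub_cancel_right,
    upperRow, (isMergeOrder_extendOrder hh hB s).mergeLeft_lt_mergeRight_iff hi hj,
    extendOrder_of_nonneg h0]

end Construction

/-! ### The order of letters along rows and columns -/

/-- The letter `b` may stand to the right of the letter `a`, in a row. -/
def RightLE (a b : Letter) : Prop := a < b ∨ (a = b ∧ ¬ a.Primed)

/-- The letter `b` may stand below the letter `a`, in a column. -/
def DownLE (a b : Letter) : Prop := a < b ∨ (a = b ∧ a.Primed)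

section Letters

variable {a b c : Letter}

theorem RightLE.le (h : RightLE a b) : a ≤ b := h.elim le_of_lt fun h => h.1.le

theorem DownLE.le (h : DownLE a b) : a ≤ b := h.elim le_of_lt fun h => h.1.le

theorem not_rightLE : ¬ RightLE a b ↔ DownLE b a := by
  unfold RightLE DownLE
  rcases lt_trichotomy a b with h | rfl | h
  · simp [h, h.ne', h.not_gt]
  · simp
  · simp [h, h.ne', h.not_gt]

theorem RightLE.trans_le (h1 : RightLE a b) (h2 : b ≤ c) : RightLE a c := by
  rcases h1 with h1 | ⟨rfl, h1⟩
  · exact Or.inl (h1.trans_le h2)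
  · exact h2.lt_or_eq.imp id fun h => ⟨h, h1⟩

theorem RightLE.trans_le' (h2 : a ≤ b) (h1 : RightLE b c) : RightLE a c := by
  rcases h1 with h1 | ⟨rfl, h1⟩
  · exact Or.inl (h2.trans_lt h1)
  · exact h2.lt_or_eq.imp id fun h => ⟨h, h ▸ h1⟩

theorem DownLE.trans_le (h1 : DownLE a b) (h2 : b ≤ c) : DownLE a c := by
  rcases h1 with h1 | ⟨rfl, h1⟩
  · exact Or.inl (h1.trans_le h2)
  · exact h2.lt_or_eq.imp id fun h => ⟨h, h1⟩

theorem DownLE.trans_le' (h2 : a ≤ b) (h1 : DownLE b c) : DownLE a c := by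
  rcases h1 with h1 | ⟨rfl, h1⟩
  · exact Or.inl (h2.trans_lt h1)
  · exact h2.lt_or_eq.imp id fun h => ⟨h, h ▸ h1⟩

theorem RightLE.trans_downLE (h1 : RightLE a b) (h2 : DownLE b c) : a < c := by
  rcases h1 with h1 | ⟨rfl, h1⟩
  · exact h1.trans_le h2.le
  · exact h2.resolve_right fun h => h1 h.2

theorem DownLE.trans_rightLE (h1 : DownLE a b) (h2 : RightLE b c) : a < c := by
  rcases h1 with h1 | ⟨rfl, h1⟩
  · exact h1.trans_le h2.le
  · exact h2.resolve_right fun h => h.2 h1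

end Letters

/-! ### Pairs of shifted tableaux, read along diagonals -/

/-- A pair of shifted set-valued tableaux whose shapes are the components of the 2-quotient: the
set `E m i` is the entry in row `i` on the diagonal `D_k` of the first component if `m = 2 * k`, of
the second component if `m = 2 * k + 1`. The entry to the right of `E m i` is `E (m + 2) i`, and the
one below `E (m + 2) i` is `E m (i + 1)`. Only the values `E m i` with `0 ≤ m` and `i < h m`
matter. -/
structure IsDiagTableau (h : ℤ → ℕ) (E : ℤ → ℕ → Finset Letter) : Prop where
  nonempty : ∀ m i, 0 ≤ m → i < h m → (E m i).Nonempty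
  right : ∀ m i, 0 ≤ m → i < h (m + 2) → ∀ a ∈ E m i, ∀ b ∈ E (m + 2) i, RightLE a b
  down : ∀ m i, 0 ≤ m → i + 1 < h m → ∀ a ∈ E (m + 2) i, ∀ b ∈ E m (i + 1), DownLE a b

namespace IsDiagTableau

variable {lam : YoungDiagram} {h : ℤ → ℕ} {E : ℤ → ℕ → Finset Letter}

theorem lt_of_lt (hh : IsProfile lam h) (hE : IsDiagTableau h E) {m : ℤ} (hm : 0 ≤ m) {i j : ℕ}
    (hij : i < j) (hj : j < h m) {a b : Letter} (ha : a ∈ E m i) (hb : b ∈ E m j) : a < b := by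
  induction j, hij using Nat.le_induction generalizing b with
  | base =>
    have := hh.step m
    obtain ⟨c, hc⟩ := hE.nonempty (m + 2) i (by omega) (by omega)
    exact (hE.right m i hm (by omega) a ha c hc).trans_downLE (hE.down m i hm hj c hc b hb)
  | succ j hij ih =>
    have := hh.step m
    obtain ⟨d, hd⟩ := hE.nonempty m j hm (by omega)
    obtain ⟨c, hc⟩ := hE.nonempty (m + 2) j (by omega) (by omega)
    exact (ih (by omega) hd).trans
      ((hE.right m j hm (by omega) d hd c hc).trans_downLE (hE.down m j hm hj c hc b hb))

theorem rightLE_of_le (hh : IsProfile lam h) (hE : IsDiagTableau h E) {m : ℤ} (hm : 0 ≤ m)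
    {i j : ℕ} (hij : i ≤ j) (hj : j < h (m + 2)) {a b : Letter} (ha : a ∈ E m i)
    (hb : b ∈ E (m + 2) j) : RightLE a b := by
  rcases hij.lt_or_eq with h1 | rfl
  · obtain ⟨c, hc⟩ := hE.nonempty (m + 2) i (by omega) (by omega)
    exact (hE.right m i hm (by omega) a ha c hc).trans_le
      (hE.lt_of_lt hh (by omega) h1 hj hc hb).le
  · exact hE.right m i hm hj a ha b hb

theorem downLE_of_lt (hh : IsProfile lam h) (hE : IsDiagTableau h E) {m : ℤ} (hm : 0 ≤ m)
    {i j : ℕ} (hij : i < j) (hj : j < h m) {a b : Letter} (ha : a ∈ E (m + 2) i)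
    (hb : b ∈ E m j) : DownLE a b := by
  rcases (Nat.succ_le_of_lt hij).lt_or_eq with h1 | rfl
  · obtain ⟨c, hc⟩ := hE.nonempty m (i + 1) hm (by omega)
    exact (hE.down m i hm (by omega) a ha c hc).trans_le (hE.lt_of_lt hh hm h1 hj hc hb).le
  · exact hE.down m i hm hj a ha b hb

end IsDiagTableau

/-- The smallest letter of a nonempty set; `1'` for the empty set. -/
noncomputable def minLetter (A : Finset Letter) : Letter :=
  if hA : A.Nonempty then A.min' hA else toLex (1, false)

theorem isLeast_minLetter {A : Finset Letter} (hA : A.Nonempty) :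
    IsLeast (A : Set Letter) (minLetter A) := by
  rw [minLetter, dif_pos hA]
  exact A.isLeast_min' hA

theorem minLetter_mem {A : Finset Letter} (hA : A.Nonempty) : minLetter A ∈ A :=
  (isLeast_minLetter hA).1

/-- The order of the dominoes along the diagonals that is determined by their minima: for equal
minima, the domino on the smaller diagonals comes first if the letter is unprimed, and last if it
is primed. -/
def minOrder (E : ℤ → ℕ → Finset Letter) (m : ℤ) (i j : ℕ) : Prop :=
  RightLE (minLetter (E m i)) (minLetter (E (m + 1) j))

section Fillings

variable {lam : YoungDiagram} {h : ℤ → ℕ} {E : ℤ → ℕ → Finset Letter} {P : Finset Domino}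

theorem isInterlacing_minOrder (hh : IsProfile lam h) (hE : IsDiagTableau h E) :
    IsInterlacing h (minOrder E) where
  isMergeOrder m hm :=
    { anti_left := fun i i' j hi hi' _ hb => hb.trans_le'
        (hE.lt_of_lt hh hm hi hi' (minLetter_mem (hE.nonempty _ _ hm (hi.trans hi')))
          (minLetter_mem (hE.nonempty _ _ hm hi'))).le
      mono_right := fun i j j' hj hj' _ hb => hb.trans_le
        (hE.lt_of_lt hh (by omega) hj hj'
          (minLetter_mem (hE.nonempty _ _ (by omega) (hj.trans hj')))
          (minLetter_mem (hE.nonempty _ _ (by omega) hj'))).le }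
  right m i j hm _ hj hn := by
    unfold minOrder at hn ⊢
    rw [not_rightLE, show m + 1 + 1 = m + 2 by ring] at hn
    have := hh.anti m
    exact Or.inl ((hE.right m j hm hj _ (minLetter_mem (hE.nonempty _ _ hm (by omega))) _
      (minLetter_mem (hE.nonempty _ _ (by omega) hj))).trans_downLE hn)
  down m i j hm _ hj hb := by
    unfold minOrder at hb ⊢
    rw [not_rightLE, show m + 1 + 1 = m + 2 by ring]
    have := hh.step m
    exact Or.inl ((hE.down m j hm hj _ (minLetter_mem (hE.nonempty _ _ (by omega) (by omega))) _
      (minLetter_mem (hE.nonempty _ _ hm hj))).trans_rightLE hb)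

section OfOrdered

variable (hh : IsProfile lam h) (hE : IsDiagTableau h E) (hP : IsPaving lam P)
  (hO : OrderedBy P (minOrder E))

include hh hE hP in
theorem minLetter_lt_of_row_lt {d e : Domino} (hd : d ∈ P) (he : e ∈ P) (h0 : 0 ≤ d.hi)
    (hhi : d.hi = e.hi) (hr : d.row < e.row) :
    minLetter (E d.hi (rank P d)) < minLetter (E e.hi (rank P e)) := by
  have hre := hP.rank_lt hh he (by omega)
  have hrd := hP.rank_lt hh hd h0
  rw [← hhi] at hre ⊢
  exact hE.lt_of_lt hh h0 ((hP.rank_lt_rank hd he h0 hhi).2 hr) hre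
    (minLetter_mem (hE.nonempty _ _ h0 hrd)) (minLetter_mem (hE.nonempty _ _ h0 hre))

include hh hE hP hO in
theorem rightLE_of_adjacent {d e : Domino} (hd : d ∈ P) (he : e ∈ P) (h0 : 0 ≤ d.hi) {r c : ℕ}
    (hx : (r, c) ∈ d.boxes) (hy : (r, c + 1) ∈ e.boxes) :
    d = e ∨ RightLE (minLetter (E d.hi (rank P d))) (minLetter (E e.hi (rank P e))) := by
  have hx' := hx
  rw [Domino.mem_boxes] at hx hy
  push_cast at hx hy
  have h1 := d.row_le_lowRow
  have h2 := e.row_le_lowRow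
  have h3 := d.lowRow_le
  have h4 := e.lowRow_le
  rcases (show e.hi = d.hi ∨ e.hi = d.hi + 1 ∨ e.hi = d.hi + 2 by omega) with h5 | h5 | h5
  · by_cases h6 : e.lowRow = r
    · left
      refine hP.eq_of_mem_boxes hd he hx' ?_
      rw [Domino.mem_boxes]; omega
    · right; left
      refine minLetter_lt_of_row_lt hh hE hP hd he h0 h5.symm ?_
      rcases eq_or_ne d.row e.row with h7 | h7
      · have := hP.row_ne_row hd he h0 h5.symm h7
        subst this; omega
      · omega
  · right
    have := (hO d hd e he h0 h5).1 (by have := hP.row_ne_lowRow hd he h0 h5; omega)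
    rw [h5]; exact this
  · right
    have hr := (hP.row_le_lowRow_iff hd he h0 h5).1 (by omega)
    have hre := hP.rank_lt hh he (by omega)
    rw [h5] at hre ⊢
    exact hE.rightLE_of_le hh h0 hr hre
      (minLetter_mem (hE.nonempty _ _ h0 (hP.rank_lt hh hd h0)))
      (minLetter_mem (hE.nonempty _ _ (by omega) hre))

include hh hE hP hO in
theorem downLE_of_adjacent {d e : Domino} (hd : d ∈ P) (he : e ∈ P) (h0 : 0 ≤ e.hi) {r c : ℕ}
    (hx : (r, c) ∈ d.boxes) (hy : (r + 1, c) ∈ e.boxes) :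
    d = e ∨ DownLE (minLetter (E d.hi (rank P d))) (minLetter (E e.hi (rank P e))) := by
  have hy' := hy
  rw [Domino.mem_boxes] at hx hy
  push_cast at hx hy
  have h1 := d.row_le_lowRow
  have h2 := e.row_le_lowRow
  have h3 := d.lowRow_le
  have h4 := e.lowRow_le
  rcases (show d.hi = e.hi ∨ d.hi = e.hi + 1 ∨ d.hi = e.hi + 2 by omega) with h5 | h5 | h5
  · by_cases h6 : d.lowRow = r + 1
    · left
      refine hP.eq_of_mem_boxes hd he ?_ hy'
      rw [Domino.mem_boxes]; push_cast; omega
    · right; left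
      refine minLetter_lt_of_row_lt hh hE hP hd he (by omega) h5 ?_
      rcases eq_or_ne d.row e.row with h7 | h7
      · have := hP.row_ne_row hd he (by omega) h5 h7
        subst this; omega
      · omega
  · right
    have := (hO e he d hd h0 h5).not.1 (by have := hP.row_ne_lowRow he hd h0 h5; omega)
    rw [h5, ← not_rightLE]; exact this
  · right
    have hr := (hP.row_le_lowRow_iff he hd h0 h5).not.1 (by omega)
    have hrd := hP.rank_lt hh hd (by omega)
    rw [h5] at hrd ⊢
    exact hE.downLE_of_lt hh h0 (not_le.1 hr) (hP.rank_lt hh he h0)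
      (minLetter_mem (hE.nonempty _ _ (by omega) hrd))
      (minLetter_mem (hE.nonempty _ _ h0 (hP.rank_lt hh he h0)))

include hh hE hP hO in
theorem rightLE_of_row {d e : Domino} (hd : d ∈ P) (he : e ∈ P) (h0 : 0 ≤ d.hi) {r c n : ℕ}
    (hx : (r, c) ∈ d.boxes) (hy : (r, c + n + 1) ∈ e.boxes) :
    d = e ∨ RightLE (minLetter (E d.hi (rank P d))) (minLetter (E e.hi (rank P e))) := by
  induction n generalizing e with
  | zero => exact rightLE_of_adjacent hh hE hP hO hd he h0 hx hy
  | succ n ih =>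
    obtain ⟨f, hf, hz⟩ := hP.exists_mem (x := (r, c + n + 1))
      (lam.up_left_mem le_rfl (by omega) (hP.mem_of_mem_boxes he hy))
    have hf0 : 0 ≤ f.hi := by
      rw [Domino.mem_boxes] at hx hz
      push_cast at hz
      omega
    rcases ih hf hz with rfl | h1
    · exact rightLE_of_adjacent hh hE hP hO hf he hf0 hz hy
    · rcases rightLE_of_adjacent hh hE hP hO hf he hf0 hz hy with rfl | h2
      · exact Or.inr h1
      · exact Or.inr (h1.trans_le h2.le)

include hh hE hP hO in
theorem downLE_of_column {d e : Domino} (hd : d ∈ P) (he : e ∈ P) (h0 : 0 ≤ e.hi) {r c n : ℕ}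
    (hx : (r, c) ∈ d.boxes) (hy : (r + n + 1, c) ∈ e.boxes) :
    d = e ∨ DownLE (minLetter (E d.hi (rank P d))) (minLetter (E e.hi (rank P e))) := by
  induction n generalizing e with
  | zero => exact downLE_of_adjacent hh hE hP hO hd he h0 hx hy
  | succ n ih =>
    obtain ⟨f, hf, hz⟩ := hP.exists_mem (x := (r + n + 1, c))
      (lam.up_left_mem (by omega) le_rfl (hP.mem_of_mem_boxes he hy))
    have hf0 : 0 ≤ f.hi := by
      rw [Domino.mem_boxes] at hy hz
      push_cast at hy hz
      omega
    rcases ih hf hf0 hz with rfl | h1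
    · exact downLE_of_adjacent hh hE hP hO hf he h0 hz hy
    · rcases downLE_of_adjacent hh hE hP hO hf he h0 hz hy with rfl | h2
      · exact Or.inr h1
      · exact Or.inr (h1.trans_le h2.le)

include hh hE hP hO in
/-- If the dominoes of a paving are ordered along the diagonals by their minima, then the minima
form a shifted domino tableau. -/
theorem isShiftedDominoFilling_of_orderedBy :
    IsShiftedDominoFilling P fun d => minLetter (E d.hi (rank P d)) := by
  have row : ∀ d ∈ upDominoes P, ∀ e ∈ upDominoes P, ∀ x ∈ d.boxes, ∀ y ∈ e.boxes,
      x.1 = y.1 → x.2 < y.2 →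
      d = e ∨ RightLE (minLetter (E d.hi (rank P d))) (minLetter (E e.hi (rank P e))) := by
    rintro d hd e he ⟨r, c⟩ hx ⟨r', c'⟩ hy (rfl : r = r') (hlt : c < c')
    obtain ⟨n, rfl⟩ := Nat.exists_eq_add_of_lt hlt
    rw [mem_upDominoes] at hd he
    exact rightLE_of_row hh hE hP hO hd.1 he.1 hd.2 hx hy
  have col : ∀ d ∈ upDominoes P, ∀ e ∈ upDominoes P, ∀ x ∈ d.boxes, ∀ y ∈ e.boxes,
      x.2 = y.2 → x.1 < y.1 →
      d = e ∨ DownLE (minLetter (E d.hi (rank P d))) (minLetter (E e.hi (rank P e))) := by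
    rintro d hd e he ⟨r, c⟩ hx ⟨r', c'⟩ hy (rfl : c = c') (hlt : r < r')
    obtain ⟨n, rfl⟩ := Nat.exists_eq_add_of_lt hlt
    rw [mem_upDominoes] at hd he
    exact downLE_of_column hh hE hP hO hd.1 he.1 he.2 hx hy
  have same : ∀ d ∈ upDominoes P, ∀ e ∈ upDominoes P, ∀ x ∈ d.boxes, ∀ y ∈ e.boxes,
      x = y → d = e := by
    rintro d hd e he x hx y hy rfl
    rw [mem_upDominoes] at hd he
    exact hP.eq_of_mem_boxes hd.1 he.1 hx hy
  constructor
  · intro d hd e he x hx y hy h1 h2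
    rcases row d hd e he x hx y hy h1 h2 with rfl | h3
    · exact le_rfl
    · exact h3.le
  · intro d hd e he x hx y hy h1 h2
    rcases col d hd e he x hx y hy h1 h2 with rfl | h3
    · exact le_rfl
    · exact h3.le
  · intro d hd e he x hx y hy h1 h2 h3
    rcases lt_trichotomy x.1 y.1 with h4 | h4 | h4
    · exact (col d hd e he x hx y hy h1 h4).resolve_right
        fun h => h.elim (fun h => h.ne h2) fun h => h3 h.2
    · exact same d hd e he x hx y hy (Prod.ext h4 h1)
    · exact ((col e he d hd y hy x hx h1.symm h4).resolve_right
        fun h => h.elim (fun h => h.ne' h2) fun h => h3 (h2 ▸ h.2)).symm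
  · intro d hd e he x hx y hy h1 h2 h3
    rcases lt_trichotomy x.2 y.2 with h4 | h4 | h4
    · exact (row d hd e he x hx y hy h1 h4).resolve_right
        fun h => h.elim (fun h => h.ne h2) fun h => h.2 h3
    · exact same d hd e he x hx y hy (Prod.ext h1 h4)
    · exact ((row e he d hd y hy x hx h1.symm h4).resolve_right
        fun h => h.elim (fun h => h.ne' h2) fun h => h.2 (h2 ▸ h3)).symm

end OfOrdered

/-! ### Shifted domino tableaux determine the order along diagonals -/

namespace IsShiftedDominoFilling

variable {g : Domino → Letter}

theorem eq_or_rightLE (hg : IsShiftedDominoFilling P g) (hP : IsPaving lam P) {d e : Domino}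
    (hd : d ∈ upDominoes P) (he : e ∈ upDominoes P) {r c c' : ℕ} (hx : (r, c) ∈ d.boxes)
    (hy : (r, c') ∈ e.boxes) (hcc : c ≤ c') : d = e ∨ RightLE (g d) (g e) := by
  rcases hcc.lt_or_eq with h1 | rfl
  · rw [or_iff_not_imp_left]
    intro hne
    rcases (hg.row_weak d hd e he _ hx _ hy rfl h1).lt_or_eq with h2 | h2
    · exact Or.inl h2
    · exact Or.inr ⟨h2, fun hp => hne (hg.row_primed d hd e he _ hx _ hy rfl h2 hp)⟩
  · exact Or.inl (hP.eq_of_mem_boxes (mem_upDominoes.1 hd).1 (mem_upDominoes.1 he).1 hx hy)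

theorem eq_or_downLE (hg : IsShiftedDominoFilling P g) (hP : IsPaving lam P) {d e : Domino}
    (hd : d ∈ upDominoes P) (he : e ∈ upDominoes P) {r r' c : ℕ} (hx : (r, c) ∈ d.boxes)
    (hy : (r', c) ∈ e.boxes) (hrr : r ≤ r') : d = e ∨ DownLE (g d) (g e) := by
  rcases hrr.lt_or_eq with h1 | rfl
  · rw [or_iff_not_imp_left]
    intro hne
    rcases (hg.col_weak d hd e he _ hx _ hy rfl h1).lt_or_eq with h2 | h2
    · exact Or.inl h2
    · refine Or.inr ⟨h2, ?_⟩
      by_contra hp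
      exact hne (hg.col_unprimed d hd e he _ hx _ hy rfl h2 hp)
  · exact Or.inl (hP.eq_of_mem_boxes (mem_upDominoes.1 hd).1 (mem_upDominoes.1 he).1 hx hy)

/-- Two boxes, the second one weakly southeast of the first one, are compared through the box in the
row of the first and the column of the second one, provided that it is not in the domino of the
first box. -/
theorem rightLE_of_southeast (hg : IsShiftedDominoFilling P g) (hP : IsPaving lam P) {d e : Domino}
    (hd : d ∈ upDominoes P) (he : e ∈ upDominoes P) {r c r' c' : ℕ} (hx : (r, c) ∈ d.boxes)
    (hy : (r', c') ∈ e.boxes) (hr : r ≤ r') (hc : c ≤ c') (hdiag : d.hi < (c' : ℤ) - r) :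
    RightLE (g d) (g e) := by
  rw [mem_upDominoes] at hd he
  obtain ⟨f, hf, hz⟩ := hP.exists_mem (x := (r, c'))
    (lam.up_left_mem hr le_rfl (hP.mem_of_mem_boxes he.1 hy))
  have hfhi := Domino.mem_boxes.1 hz
  have hf' : f ∈ upDominoes P := mem_upDominoes.2 ⟨hf, by omega⟩
  have h1 := (hg.eq_or_rightLE hP (mem_upDominoes.2 hd) hf' hx hz hc).resolve_left
    (by rintro rfl; omega)
  rcases hg.eq_or_downLE hP hf' (mem_upDominoes.2 he) hz hy hr with rfl | h2
  · exact h1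
  · exact h1.trans_le h2.le

theorem downLE_of_southeast (hg : IsShiftedDominoFilling P g) (hP : IsPaving lam P) {d e : Domino}
    (hd : d ∈ upDominoes P) (he : e ∈ upDominoes P) {r c r' c' : ℕ} (hx : (r, c) ∈ d.boxes)
    (hy : (r', c') ∈ e.boxes) (hr : r ≤ r') (hc : c ≤ c') (hdiag : e.hi < (c' : ℤ) - r) :
    DownLE (g d) (g e) := by
  rw [mem_upDominoes] at hd he
  obtain ⟨f, hf, hz⟩ := hP.exists_mem (x := (r, c'))
    (lam.up_left_mem hr le_rfl (hP.mem_of_mem_boxes he.1 hy))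
  have hfhi := Domino.mem_boxes.1 hz
  have hf' : f ∈ upDominoes P := mem_upDominoes.2 ⟨hf, by omega⟩
  have h1 := (hg.eq_or_downLE hP hf' (mem_upDominoes.2 he) hz hy hr).resolve_left
    (by rintro rfl; omega)
  rcases hg.eq_or_rightLE hP (mem_upDominoes.2 hd) hf' hx hz hc with rfl | h2
  · exact h1
  · exact DownLE.trans_le' h2.le h1

theorem row_lt_lowRow_iff (hg : IsShiftedDominoFilling P g) (hP : IsPaving lam P) {d e : Domino}
    (hd : d ∈ P) (he : e ∈ P) (h0 : 0 ≤ d.hi) (h : e.hi = d.hi + 1) :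
    d.row < e.lowRow ↔ RightLE (g d) (g e) := by
  obtain ⟨m, hm⟩ := Int.eq_ofNat_of_zero_le h0
  have hd' := mem_upDominoes.2 ⟨hd, h0⟩
  have he' := mem_upDominoes.2 ⟨he, (show 0 ≤ e.hi by omega)⟩
  have hx := IsPaving.row_mem_boxes hm
  have hy := IsPaving.lowRow_mem_boxes (d := e) (m := m) (by omega)
  constructor
  · intro hlt
    exact hg.rightLE_of_southeast hP hd' he' hx hy hlt.le (by omega) (by push_cast; omega)
  · intro hle
    by_contra hcon
    have hne := hP.row_ne_lowRow hd he h0 h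
    exact not_rightLE.2 (hg.downLE_of_southeast hP he' hd' hy hx (by omega) (by omega)
      (by push_cast; omega)) hle

end IsShiftedDominoFilling

end Fillings

/-! ### Shifted set-valued domino tableaux, read along diagonals -/

/-- The entry of the domino with `hi = m` and rank `i`, and `∅` if there is none. -/
def diagEntry (P : Finset Domino) (f : Domino → Finset Letter) (m : ℤ) (i : ℕ) : Finset Letter :=
  (P.filter fun d => d.hi = m ∧ rank P d = i).biUnion f

theorem diagEntry_eq {lam : YoungDiagram} {P : Finset Domino} (hP : IsPaving lam P)
    (f : Domino → Finset Letter) {d : Domino} (hd : d ∈ P) (h0 : 0 ≤ d.hi) :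
    diagEntry P f d.hi (rank P d) = f d := by
  have : (P.filter fun e => e.hi = d.hi ∧ rank P e = rank P d) = {d} := by
    ext e
    simp only [Finset.mem_filter, Finset.mem_singleton]
    constructor
    · rintro ⟨he, h1, h2⟩
      exact hP.eq_of_rank_eq he hd (by omega) h1 h2
    · rintro rfl
      exact ⟨hd, rfl, rfl⟩
  rw [diagEntry, this, Finset.singleton_biUnion]

theorem rank_upDominoes (P : Finset Domino) {d : Domino} (h0 : 0 ≤ d.hi) :
    rank (upDominoes P) d = rank P d := by
  unfold rank
  congr 1
  ext e
  simp only [Finset.mem_filter, mem_upDominoes]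
  constructor
  · rintro ⟨⟨h1, _⟩, h2⟩
    exact ⟨h1, h2⟩
  · rintro ⟨h1, h2⟩
    exact ⟨⟨h1, by omega⟩, h2⟩

namespace ShiftedSVDT

variable {lam : YoungDiagram} {h : ℤ → ℕ}

theorem diagEntry_upDominoes (S : ShiftedSVDT lam) :
    diagEntry (upDominoes S.paving) S.entry = diagEntry S.paving S.entry := by
  funext m i
  ext a
  simp only [diagEntry, Finset.mem_biUnion, Finset.mem_filter]
  constructor
  · rintro ⟨d, ⟨h1, h2, h3⟩, ha⟩
    rw [rank_upDominoes _ (mem_upDominoes.1 h1).2] at h3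
    exact ⟨d, ⟨(mem_upDominoes.1 h1).1, h2, h3⟩, ha⟩
  · rintro ⟨d, ⟨h1, h2, h3⟩, ha⟩
    have hd : d ∈ upDominoes S.paving := by
      by_contra hd
      rw [S.entry_eq_empty d hd] at ha
      simp at ha
    rw [← rank_upDominoes _ (mem_upDominoes.1 hd).2] at h3
    exact ⟨d, ⟨hd, h2, h3⟩, ha⟩

theorem mem_up {S : ShiftedSVDT lam} {d : Domino} {A : Finset Letter} :
    (d, A) ∈ S.up ↔ d ∈ upDominoes S.paving ∧ S.entry d = A := by
  simp only [up, Finset.mem_image, Prod.mk.injEq]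
  constructor
  · rintro ⟨e, he, rfl, rfl⟩; exact ⟨he, rfl⟩
  · rintro ⟨hd, rfl⟩; exact ⟨d, hd, rfl, rfl⟩

theorem diagEntry_eq_of_up_eq {S S' : ShiftedSVDT lam} (hup : S.up = S'.up) :
    diagEntry S.paving S.entry = diagEntry S'.paving S'.entry := by
  have hdom : upDominoes S.paving = upDominoes S'.paving := by
    ext d
    constructor
    · intro hd
      have : (d, S.entry d) ∈ S'.up := by rw [← hup]; exact mem_up.2 ⟨hd, rfl⟩
      exact (mem_up.1 this).1
    · intro hd
      have : (d, S'.entry d) ∈ S.up := by rw [hup]; exact mem_up.2 ⟨hd, rfl⟩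
      exact (mem_up.1 this).1
  have hentry : S.entry = S'.entry := by
    funext d
    by_cases hd : d ∈ upDominoes S.paving
    · have : (d, S.entry d) ∈ S'.up := by rw [← hup]; exact mem_up.2 ⟨hd, rfl⟩
      exact (mem_up.1 this).2.symm
    · rw [S.entry_eq_empty d hd, S'.entry_eq_empty d (hdom ▸ hd)]
  rw [← diagEntry_upDominoes, ← diagEntry_upDominoes, hdom, hentry]

theorem exists_isShiftedDominoFilling_minLetter (S : ShiftedSVDT lam) :
    ∃ g, (∀ d ∈ upDominoes S.paving, g d = minLetter (S.entry d)) ∧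
      IsShiftedDominoFilling S.paving g := by
  obtain ⟨g, h1, h2⟩ := S.min_filling
  exact ⟨g, fun d hd => (h1 d hd).unique (isLeast_minLetter (S.entry_nonempty d hd)), h2⟩

theorem orderedBy_minOrder (S : ShiftedSVDT lam) :
    OrderedBy S.paving (minOrder (diagEntry S.paving S.entry)) := by
  obtain ⟨g, h1, h2⟩ := S.exists_isShiftedDominoFilling_minLetter
  have hP := S.isShiftedPaving.toIsPaving
  intro d hd e he h0 hhi
  rw [h2.row_lt_lowRow_iff hP hd he h0 hhi, minOrder, ← hhi, diagEntry_eq hP _ hd h0,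
    diagEntry_eq hP _ he (by omega), h1 d (mem_upDominoes.2 ⟨hd, h0⟩),
    h1 e (mem_upDominoes.2 ⟨he, by omega⟩)]

theorem isDiagTableau_diagEntry (hh : IsProfile lam h) (S : ShiftedSVDT lam) :
    IsDiagTableau h (diagEntry S.paving S.entry) := by
  have hP := S.isShiftedPaving.toIsPaving
  constructor
  · intro m i hm hi
    obtain ⟨d, hd, rfl, rfl⟩ := hP.exists_rank hh hm hi
    rw [diagEntry_eq hP _ hd hm]
    exact S.entry_nonempty d (mem_upDominoes.2 ⟨hd, hm⟩)
  · intro m i hm hi a ha b hb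
    have := hh.anti m
    obtain ⟨d, hd, rfl, rfl⟩ := hP.exists_rank hh hm (show i < h m by omega)
    obtain ⟨e, he, hhi, hr⟩ := hP.exists_rank hh (show 0 ≤ d.hi + 2 by omega) hi
    rw [diagEntry_eq hP _ hd hm] at ha
    rw [← hr, ← hhi, diagEntry_eq hP _ he (by omega)] at hb
    have hd' := mem_upDominoes.2 ⟨hd, hm⟩
    have he' := mem_upDominoes.2 ⟨he, (show 0 ≤ e.hi by omega)⟩
    have hst : d.SameType e := by
      rw [Domino.SameType, Domino.isType1_iff, Domino.isType1_iff]; omega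
    have hse := (hP.weaklySoutheast_right_iff hd he hm hhi).2 hr.ge
    have hdiag : e.diag = d.diag + 2 := by rw [Domino.diag_eq, Domino.diag_eq]; omega
    rcases (S.southeast_le d hd' e he' hst hse (Or.inl hdiag) a ha b hb).lt_or_eq with h1 | rfl
    · exact Or.inl h1
    · refine Or.inr ⟨rfl, fun hp => ?_⟩
      -- an element that is also in the next entry is the largest one
      have hmax : IsGreatest (S.entry d : Set Letter) a :=
        ⟨ha, fun c hc => S.southeast_le d hd' e he' hst hse (Or.inl hdiag) c hc a hb⟩
      exact lt_irrefl a (S.southeast_lt_primed d hd' e he' hst hse hdiag a hmax hp a ha a hb)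
  · intro m i hm hi a ha b hb
    have := hh.step m
    obtain ⟨e, he, rfl, hr⟩ := hP.exists_rank hh hm hi
    obtain ⟨d, hd, hhi, rfl⟩ := hP.exists_rank hh (show 0 ≤ e.hi + 2 by omega)
      (show i < h (e.hi + 2) by omega)
    rw [← hr, diagEntry_eq hP _ he hm] at hb
    rw [← hhi, diagEntry_eq hP _ hd (by omega)] at ha
    have he' := mem_upDominoes.2 ⟨he, hm⟩
    have hd' := mem_upDominoes.2 ⟨hd, (show 0 ≤ d.hi by omega)⟩
    have hst : d.SameType e := by
      rw [Domino.SameType, Domino.isType1_iff, Domino.isType1_iff]; omega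
    have hse := (hP.weaklySoutheast_down_iff hd he hm hhi).2 (by omega)
    have hdiag : d.diag = e.diag + 2 := by rw [Domino.diag_eq, Domino.diag_eq]; omega
    rcases (S.southeast_le d hd' e he' hst hse (Or.inr hdiag) a ha b hb).lt_or_eq with h1 | rfl
    · exact Or.inl h1
    · refine Or.inr ⟨rfl, ?_⟩
      by_contra hp
      have hmax : IsGreatest (S.entry d : Set Letter) a :=
        ⟨ha, fun c hc => S.southeast_le d hd' e he' hst hse (Or.inr hdiag) c hc a hb⟩
      exact lt_irrefl a (S.southeast_lt_unprimed d hd' e he' hst hse hdiag a hmax hp a ha a hb)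

theorem up_eq_of_diagEntry_eq (hh : IsProfile lam h) {S S' : ShiftedSVDT lam}
    (hE : diagEntry S.paving S.entry = diagEntry S'.paving S'.entry) : S.up = S'.up := by
  have key : ∀ S S' : ShiftedSVDT lam,
      diagEntry S.paving S.entry = diagEntry S'.paving S'.entry → S.up ⊆ S'.up := by
    intro S S' hE
    have hP := S.isShiftedPaving.toIsPaving
    have hP' := S'.isShiftedPaving.toIsPaving
    rintro ⟨d, A⟩ hdA
    obtain ⟨hd, rfl⟩ := mem_up.1 hdA
    obtain ⟨hd, h0⟩ := mem_upDominoes.1 hd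
    obtain ⟨d', hd', hhi, hr⟩ := hP'.exists_rank hh h0 (hP.rank_lt hh hd h0)
    obtain rfl : d = d' := S.isShiftedPaving.eq_of_orderedBy hh S'.isShiftedPaving
      S.orderedBy_minOrder (hE ▸ S'.orderedBy_minOrder) hd hd' h0 hhi.symm hr.symm
    refine mem_up.2 ⟨mem_upDominoes.2 ⟨hd', h0⟩, ?_⟩
    rw [← diagEntry_eq hP S.entry hd h0, ← diagEntry_eq hP' S'.entry hd' h0, hE, hr]
  exact (key S S' hE).antisymm (key S' S hE.symm)

theorem diagEntry_eq_empty (hh : IsProfile lam h) (S : ShiftedSVDT lam) (m : ℤ) (i : ℕ)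
    (hmi : ¬ (0 ≤ m ∧ i < h m)) : diagEntry S.paving S.entry m i = ∅ := by
  refine Finset.subset_empty.1 fun a ha => ?_
  simp only [diagEntry, Finset.mem_biUnion, Finset.mem_filter] at ha
  obtain ⟨d, ⟨hd, rfl, rfl⟩, ha⟩ := ha
  by_cases h0 : 0 ≤ d.hi
  · exact absurd ⟨h0, S.isShiftedPaving.toIsPaving.rank_lt hh hd h0⟩ hmi
  · rw [S.entry_eq_empty d fun hd => h0 (mem_upDominoes.1 hd).2] at ha
    exact ha

theorem exists_diagEntry_eq (hh : IsProfile lam h) (hlam : IsShiftedPavable lam)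
    {E : ℤ → ℕ → Finset Letter} (hE : IsDiagTableau h E)
    (hout : ∀ m i, ¬ (0 ≤ m ∧ i < h m) → E m i = ∅) :
    ∃ S : ShiftedSVDT lam, diagEntry S.paving S.entry = E := by
  classical
  obtain ⟨P₀, hP₀⟩ := hlam
  have hB := isInterlacing_minOrder hh hE
  obtain ⟨P, hP, hO, hbad⟩ : ∃ P, IsPaving lam P ∧ OrderedBy P (minOrder E) ∧
      ¬ ∃ d ∈ P, d.vertical = true ∧ d.diag = 0 ∧
        (∃ e ∈ P, e.DirectlyLeft d) ∧ ∀ e ∈ P, e.DirectlyLeft d → e.diag < 0 :=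
    ⟨_, isPaving_orderPaving hh hB, orderedBy_orderPaving hh hB, no_bad_vertical_orderPaving hh hB⟩
  let f : Domino → Finset Letter := fun d => if d ∈ upDominoes P then E d.hi (rank P d) else ∅
  have hf : ∀ d ∈ upDominoes P, f d = E d.hi (rank P d) := fun d hd => if_pos hd
  have hne : ∀ d ∈ upDominoes P, (E d.hi (rank P d)).Nonempty := fun d hd =>
    hE.nonempty _ _ (mem_upDominoes.1 hd).2
      (hP.rank_lt hh (mem_upDominoes.1 hd).1 (mem_upDominoes.1 hd).2)
  have right : ∀ d ∈ upDominoes P, ∀ e ∈ upDominoes P, d.SameType e → e.WeaklySoutheast d →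
      e.diag = d.diag + 2 → ∀ a ∈ f d, ∀ b ∈ f e, RightLE a b := by
    intro d hd e he hst hse hdiag a ha b hb
    rw [hf d hd] at ha
    rw [hf e he] at hb
    rw [mem_upDominoes] at hd he
    rw [Domino.SameType, Domino.isType1_iff, Domino.isType1_iff] at hst
    rw [Domino.diag_eq, Domino.diag_eq] at hdiag
    have hhi : e.hi = d.hi + 2 := by omega
    have hre := hP.rank_lt hh he.1 he.2
    rw [hP.weaklySoutheast_right_iff hd.1 he.1 hd.2 hhi] at hse
    rw [hhi] at hb hre
    exact hE.rightLE_of_le hh hd.2 hse hre ha hb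
  have down : ∀ d ∈ upDominoes P, ∀ e ∈ upDominoes P, d.SameType e → e.WeaklySoutheast d →
      d.diag = e.diag + 2 → ∀ a ∈ f d, ∀ b ∈ f e, DownLE a b := by
    intro d hd e he hst hse hdiag a ha b hb
    rw [hf d hd] at ha
    rw [hf e he] at hb
    rw [mem_upDominoes] at hd he
    rw [Domino.SameType, Domino.isType1_iff, Domino.isType1_iff] at hst
    rw [Domino.diag_eq, Domino.diag_eq] at hdiag
    have hhi : d.hi = e.hi + 2 := by omega
    have hre := hP.rank_lt hh he.1 he.2
    rw [hP.weaklySoutheast_down_iff hd.1 he.1 he.2 hhi] at hse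
    rw [hhi] at ha
    exact hE.downLE_of_lt hh he.2 hse hre ha hb
  let S : ShiftedSVDT lam :=
    { paving := P
      isShiftedPaving := ⟨hP, hP₀.lastPart_left, hP₀.lastPart_right, hbad⟩
      entry := f
      entry_nonempty := fun d hd => by rw [hf d hd]; exact hne d hd
      entry_eq_empty := fun d hd => if_neg hd
      min_filling := ⟨_, fun d hd => by rw [hf d hd]; exact isLeast_minLetter (hne d hd),
        isShiftedDominoFilling_of_orderedBy hh hE hP hO⟩
      southeast_le := by
        rintro d hd e he hst hse (hdiag | hdiag) a ha b hb
        · exact (right d hd e he hst hse hdiag a ha b hb).le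
        · exact (down d hd e he hst hse hdiag a ha b hb).le
      southeast_lt_primed := by
        intro d hd e he hst hse hdiag m hm hp a ha b hb
        refine lt_of_le_of_lt (hm.2 ha) ?_
        exact (right d hd e he hst hse hdiag m hm.1 b hb).resolve_right fun h => h.2 hp
      southeast_lt_unprimed := by
        intro d hd e he hst hse hdiag m hm hp a ha b hb
        refine lt_of_le_of_lt (hm.2 ha) ?_
        exact (down d hd e he hst hse hdiag m hm.1 b hb).resolve_right fun h => hp h.2 }
  refine ⟨S, ?_⟩
  funext m i
  by_cases hmi : 0 ≤ m ∧ i < h m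
  · obtain ⟨d, hd, rfl, rfl⟩ := hP.exists_rank hh hmi.1 hmi.2
    exact (diagEntry_eq hP f hd hmi.1).trans (hf d (mem_upDominoes.2 ⟨hd, hmi.1⟩))
  · rw [hout m i hmi, S.diagEntry_eq_empty hh m i hmi]

end ShiftedSVDT

/-! ### Shifted set-valued tableaux in terms of adjacent boxes -/

theorem mem_upBoxes {X : YoungDiagram} {i j : ℕ} : (i, j) ∈ upBoxes X ↔ (i, j) ∈ X ∧ i ≤ j := by
  simp [upBoxes]

namespace ShiftedSVT

variable {X : YoungDiagram}

theorem ext_entry {T T' : ShiftedSVT X} (h : T.entry = T'.entry) : T = T' := by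
  cases T; cases T'; simp_all

theorem rightLE (T : ShiftedSVT X) {i j j' : ℕ} (hij : i ≤ j) (hj : j < j') (hX : (i, j') ∈ X)
    {a b : Letter} (ha : a ∈ T.entry (i, j)) (hb : b ∈ T.entry (i, j')) : RightLE a b := by
  have h1 : (i, j) ∈ upBoxes X := mem_upBoxes.2 ⟨X.up_left_mem le_rfl hj.le hX, hij⟩
  have h2 : (i, j') ∈ upBoxes X := mem_upBoxes.2 ⟨hX, by omega⟩
  rcases (T.row_weak _ h1 _ h2 rfl hj a ha b hb).lt_or_eq with h | rfl
  · exact Or.inl h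
  · refine Or.inr ⟨rfl, fun hp => ?_⟩
    have := T.row_primed a hp _ h1 _ h2 rfl ha hb
    simp only [Prod.mk.injEq] at this
    omega

theorem downLE (T : ShiftedSVT X) {i i' j : ℕ} (hij : i' ≤ j) (hi : i < i') (hX : (i', j) ∈ X)
    {a b : Letter} (ha : a ∈ T.entry (i, j)) (hb : b ∈ T.entry (i', j)) : DownLE a b := by
  have h1 : (i, j) ∈ upBoxes X := mem_upBoxes.2 ⟨X.up_left_mem hi.le le_rfl hX, by omega⟩
  have h2 : (i', j) ∈ upBoxes X := mem_upBoxes.2 ⟨hX, hij⟩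
  rcases (T.col_weak _ h1 _ h2 rfl hi a ha b hb).lt_or_eq with h | rfl
  · exact Or.inl h
  · refine Or.inr ⟨rfl, ?_⟩
    by_contra hp
    have := T.col_unprimed a hp _ h1 _ h2 rfl ha hb
    simp only [Prod.mk.injEq] at this
    omega

/-- It suffices to check the conditions of a shifted set-valued tableau for adjacent boxes. -/
theorem exists_entry_eq {e : ℕ × ℕ → Finset Letter} (hne : ∀ c ∈ upBoxes X, (e c).Nonempty)
    (hempty : ∀ c, c ∉ upBoxes X → e c = ∅)
    (hright : ∀ i j, i ≤ j → (i, j + 1) ∈ X → ∀ a ∈ e (i, j), ∀ b ∈ e (i, j + 1), RightLE a b)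
    (hdown : ∀ i j, i + 1 ≤ j → (i + 1, j) ∈ X →
      ∀ a ∈ e (i, j), ∀ b ∈ e (i + 1, j), DownLE a b) :
    ∃ T : ShiftedSVT X, T.entry = e := by
  have row : ∀ c ∈ upBoxes X, ∀ d ∈ upBoxes X, c.1 = d.1 → c.2 < d.2 →
      ∀ a ∈ e c, ∀ b ∈ e d, RightLE a b := by
    rintro ⟨i, j⟩ hc ⟨i', j'⟩ hd (rfl : i = i') (hlt : j < j') a ha b hb
    rw [mem_upBoxes] at hc hd
    induction j', hlt using Nat.le_induction generalizing b with
    | base => exact hright i j hc.2 hd.1 a ha b hb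
    | succ k hk ih =>
      have hk' : (i, k) ∈ X ∧ i ≤ k := ⟨X.up_left_mem le_rfl (by omega) hd.1, by omega⟩
      obtain ⟨x, hx⟩ := hne _ (mem_upBoxes.2 hk')
      exact (ih hk' x hx).trans_le (hright i k hk'.2 hd.1 x hx b hb).le
  have col : ∀ c ∈ upBoxes X, ∀ d ∈ upBoxes X, c.2 = d.2 → c.1 < d.1 →
      ∀ a ∈ e c, ∀ b ∈ e d, DownLE a b := by
    rintro ⟨i, j⟩ hc ⟨i', j'⟩ hd (rfl : j = j') (hlt : i < i') a ha b hb
    rw [mem_upBoxes] at hc hd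
    induction i', hlt using Nat.le_induction generalizing b with
    | base => exact hdown i j hd.2 hd.1 a ha b hb
    | succ k hk ih =>
      have hk' : (k, j) ∈ X ∧ k ≤ j := ⟨X.up_left_mem (by omega) le_rfl hd.1, by omega⟩
      obtain ⟨x, hx⟩ := hne _ (mem_upBoxes.2 hk')
      exact (ih hk' x hx).trans_le (hdown k j hd.2 hd.1 x hx b hb).le
  refine ⟨⟨e, hne, hempty, fun c hc d hd h1 h2 a ha b hb => (row c hc d hd h1 h2 a ha b hb).le,
    fun c hc d hd h1 h2 a ha b hb => (col c hc d hd h1 h2 a ha b hb).le, ?_, ?_⟩, rfl⟩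
  · intro a hp c hc d hd h1 ha hb
    rcases lt_trichotomy c.1 d.1 with h2 | h2 | h2
    · exact absurd (col c hc d hd h1 h2 a ha a hb) (by simp [DownLE, hp])
    · exact Prod.ext h2 h1
    · exact absurd (col d hd c hc h1.symm h2 a hb a ha) (by simp [DownLE, hp])
  · intro a hp c hc d hd h1 ha hb
    rcases lt_trichotomy c.2 d.2 with h2 | h2 | h2
    · exact absurd (row c hc d hd h1 h2 a ha a hb) (by simp [RightLE, hp])
    · exact Prod.ext h1 h2
    · exact absurd (row d hd c hc h1.symm h2 a hb a ha) (by simp [RightLE, hp])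

end ShiftedSVT

/-! ### Pairs of shifted set-valued tableaux -/

section Pairs

variable {lam X Y : YoungDiagram} {h : ℤ → ℕ}

/-- The number of boxes of `X` on the diagonals `D_k`, `k ≥ 0`, is given by the even (`ε = 0`) or
the odd (`ε = 1`) values of `h`. -/
def IsComponent (X : YoungDiagram) (h : ℤ → ℕ) (ε : ℤ) : Prop :=
  ∀ i k : ℕ, (i, i + k) ∈ X ↔ i < h (2 * k + ε)

/-- The entries of the tableaux of a pair, indexed as in `IsDiagTableau`. -/
def pairEntry (T₁ : ShiftedSVT X) (T₂ : ShiftedSVT Y) (m : ℤ) (i : ℕ) : Finset Letter :=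
  if m < 0 then ∅
  else if m % 2 = 0 then T₁.entry (i, i + (m / 2).toNat) else T₂.entry (i, i + (m / 2).toNat)

theorem pairEntry_even (T₁ : ShiftedSVT X) (T₂ : ShiftedSVT Y) (k i : ℕ) :
    pairEntry T₁ T₂ (2 * k + 0) i = T₁.entry (i, i + k) := by
  rw [pairEntry, if_neg (by omega), if_pos (by omega)]
  congr 3; omega

theorem pairEntry_odd (T₁ : ShiftedSVT X) (T₂ : ShiftedSVT Y) (k i : ℕ) :
    pairEntry T₁ T₂ (2 * k + 1) i = T₂.entry (i, i + k) := by
  rw [pairEntry, if_neg (by omega), if_neg (by omega)]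
  congr 3; omega

theorem exists_eq_two_mul_add {m : ℤ} (hm : 0 ≤ m) :
    (∃ k : ℕ, m = 2 * k + 0) ∨ ∃ k : ℕ, m = 2 * k + 1 := by
  rcases Int.emod_two_eq_zero_or_one m with h | h
  · exact Or.inl ⟨(m / 2).toNat, by omega⟩
  · exact Or.inr ⟨(m / 2).toNat, by omega⟩

theorem ShiftedSVT.entry_eq_of_diag {T T' : ShiftedSVT X}
    (hT : ∀ k i : ℕ, T.entry (i, i + k) = T'.entry (i, i + k)) : T = T' := by
  refine ShiftedSVT.ext_entry (funext fun ⟨i, j⟩ => ?_)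
  by_cases hij : i ≤ j
  · obtain ⟨k, rfl⟩ := Nat.exists_eq_add_of_le hij
    exact hT k i
  · rw [T.entry_eq_empty _ fun hc => hij (mem_upBoxes.1 hc).2,
      T'.entry_eq_empty _ fun hc => hij (mem_upBoxes.1 hc).2]

theorem pairEntry_injective {T₁ T₁' : ShiftedSVT X} {T₂ T₂' : ShiftedSVT Y}
    (hE : pairEntry T₁ T₂ = pairEntry T₁' T₂') : T₁ = T₁' ∧ T₂ = T₂' := by
  constructor
  · refine ShiftedSVT.entry_eq_of_diag fun k i => ?_
    rw [← pairEntry_even T₁ T₂, hE, pairEntry_even]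
  · refine ShiftedSVT.entry_eq_of_diag fun k i => ?_
    rw [← pairEntry_odd T₁ T₂, hE, pairEntry_odd]

theorem pairEntry_eq_empty (hX : IsComponent X h 0) (hY : IsComponent Y h 1) (T₁ : ShiftedSVT X)
    (T₂ : ShiftedSVT Y) (m : ℤ) (i : ℕ) (hmi : ¬ (0 ≤ m ∧ i < h m)) :
    pairEntry T₁ T₂ m i = ∅ := by
  by_cases hm : 0 ≤ m
  · rcases exists_eq_two_mul_add hm with ⟨k, rfl⟩ | ⟨k, rfl⟩
    · rw [pairEntry_even]
      exact T₁.entry_eq_empty _ fun hc => hmi ⟨hm, (hX i k).1 (mem_upBoxes.1 hc).1⟩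
    · rw [pairEntry_odd]
      exact T₂.entry_eq_empty _ fun hc => hmi ⟨hm, (hY i k).1 (mem_upBoxes.1 hc).1⟩
  · rw [pairEntry, if_pos (by omega)]

theorem isDiagTableau_pairEntry (hX : IsComponent X h 0) (hY : IsComponent Y h 1)
    (T₁ : ShiftedSVT X) (T₂ : ShiftedSVT Y) : IsDiagTableau h (pairEntry T₁ T₂) := by
  have e0 : ∀ k : ℕ, 2 * (k : ℤ) + 0 + 2 = 2 * ((k + 1 : ℕ) : ℤ) + 0 := fun k => by
    push_cast; ring
  have e1 : ∀ k : ℕ, 2 * (k : ℤ) + 1 + 2 = 2 * ((k + 1 : ℕ) : ℤ) + 1 := fun k => by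
    push_cast; ring
  constructor
  · intro m i hm hi
    rcases exists_eq_two_mul_add hm with ⟨k, rfl⟩ | ⟨k, rfl⟩
    · rw [pairEntry_even]
      exact T₁.entry_nonempty _ (mem_upBoxes.2 ⟨(hX i k).2 hi, by omega⟩)
    · rw [pairEntry_odd]
      exact T₂.entry_nonempty _ (mem_upBoxes.2 ⟨(hY i k).2 hi, by omega⟩)
  · intro m i hm hi a ha b hb
    rcases exists_eq_two_mul_add hm with ⟨k, rfl⟩ | ⟨k, rfl⟩
    · rw [e0] at hi hb
      rw [pairEntry_even] at ha hb
      exact T₁.rightLE (by omega) (by omega) ((hX i (k + 1)).2 hi) ha hb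
    · rw [e1] at hi hb
      rw [pairEntry_odd] at ha hb
      exact T₂.rightLE (by omega) (by omega) ((hY i (k + 1)).2 hi) ha hb
  · intro m i hm hi a ha b hb
    have e2 : ∀ k : ℕ, i + (k + 1) = i + 1 + k := fun k => by ring
    rcases exists_eq_two_mul_add hm with ⟨k, rfl⟩ | ⟨k, rfl⟩
    · rw [e0] at ha
      rw [pairEntry_even] at ha hb
      rw [e2] at ha
      exact T₁.downLE (by omega) (by omega) ((hX (i + 1) k).2 hi) ha hb
    · rw [e1] at ha
      rw [pairEntry_odd] at ha hb
      rw [e2] at ha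
      exact T₂.downLE (by omega) (by omega) ((hY (i + 1) k).2 hi) ha hb

theorem IsDiagTableau.exists_component {E : ℤ → ℕ → Finset Letter} (hE : IsDiagTableau h E)
    (hout : ∀ m i, ¬ (0 ≤ m ∧ i < h m) → E m i = ∅) {ε : ℤ} (hε : 0 ≤ ε)
    (hX : IsComponent X h ε) :
    ∃ T : ShiftedSVT X, ∀ k i : ℕ, T.entry (i, i + k) = E (2 * k + ε) i := by
  let e : ℕ × ℕ → Finset Letter := fun c =>
    if c.1 ≤ c.2 then E (2 * ((c.2 - c.1 : ℕ) : ℤ) + ε) c.1 else ∅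
  have he : ∀ k i : ℕ, e (i, i + k) = E (2 * k + ε) i := by
    intro k i
    simp [e]
  have eq : ∀ k : ℕ, 2 * (k : ℤ) + ε + 2 = 2 * ((k + 1 : ℕ) : ℤ) + ε := fun k => by
    push_cast; ring
  obtain ⟨T, hT⟩ : ∃ T : ShiftedSVT X, T.entry = e := by
    refine ShiftedSVT.exists_entry_eq ?_ ?_ ?_ ?_
    · rintro ⟨i, j⟩ hc
      rw [mem_upBoxes] at hc
      obtain ⟨k, rfl⟩ := Nat.exists_eq_add_of_le hc.2
      rw [he]
      exact hE.nonempty _ _ (by omega) ((hX i k).1 hc.1)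
    · rintro ⟨i, j⟩ hc
      by_cases hij : i ≤ j
      · obtain ⟨k, rfl⟩ := Nat.exists_eq_add_of_le hij
        rw [he]
        refine hout _ _ fun hi => hc (mem_upBoxes.2 ⟨(hX i k).2 hi.2, hij⟩)
      · simp [e, hij]
    · intro i j hij hmem a ha b hb
      obtain ⟨k, rfl⟩ := Nat.exists_eq_add_of_le hij
      rw [add_assoc] at hmem hb
      rw [he] at ha hb
      rw [hX, ← eq] at hmem
      rw [← eq] at hb
      exact hE.right _ i (by omega) hmem a ha b hb
    · intro i j hij hmem a ha b hb
      obtain ⟨k, rfl⟩ := Nat.exists_eq_add_of_le hij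
      rw [he] at hb
      rw [add_assoc, add_comm 1 k, he, ← eq] at ha
      rw [hX] at hmem
      exact hE.down _ i (by omega) hmem a ha b hb
  exact ⟨T, fun k i => by rw [hT, he]⟩

theorem IsDiagTableau.exists_pairEntry_eq (hX : IsComponent X h 0) (hY : IsComponent Y h 1)
    {E : ℤ → ℕ → Finset Letter} (hE : IsDiagTableau h E)
    (hout : ∀ m i, ¬ (0 ≤ m ∧ i < h m) → E m i = ∅) :
    ∃ (T₁ : ShiftedSVT X) (T₂ : ShiftedSVT Y), pairEntry T₁ T₂ = E := by
  obtain ⟨T₁, h1⟩ := hE.exists_component hout le_rfl hX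
  obtain ⟨T₂, h2⟩ := hE.exists_component hout zero_le_one hY
  refine ⟨T₁, T₂, funext fun m => funext fun i => ?_⟩
  by_cases hm : 0 ≤ m
  · rcases exists_eq_two_mul_add hm with ⟨k, rfl⟩ | ⟨k, rfl⟩
    · rw [pairEntry_even, h1]
    · rw [pairEntry_odd, h2]
  · rw [hout m i fun h => hm h.1, pairEntry, if_pos (by omega)]

/-! ### Weights -/

variable {M : Type*} [AddCommMonoid M]

theorem ShiftedSVDT.sum_up (S : ShiftedSVDT lam) (F : Finset Letter → M) :
    ∑ p ∈ S.up, F p.2 = ∑ d ∈ upDominoes S.paving, F (S.entry d) := by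
  rw [ShiftedSVDT.up, Finset.sum_image]
  intro d _ e _ hde
  exact congrArg Prod.fst hde

theorem ShiftedSVDT.sum_component (hh : IsProfile lam h) (S : ShiftedSVDT lam) {ε : ℤ}
    (hε : 0 ≤ ε) (hε1 : ε ≤ 1) (hX : IsComponent X h ε) (T : ShiftedSVT X)
    (hT : ∀ k i : ℕ, diagEntry S.paving S.entry (2 * k + ε) i = T.entry (i, i + k))
    (F : Finset Letter → M) :
    ∑ d ∈ upDominoes S.paving with d.hi % 2 = ε, F (S.entry d) =
      ∑ c ∈ upBoxes X, F (T.entry c) := by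
  have hP := S.isShiftedPaving.toIsPaving
  refine Finset.sum_bij
    (fun d _ => (rank S.paving d, rank S.paving d + (d.hi / 2).toNat)) ?_ ?_ ?_ ?_
  · intro d hd
    rw [Finset.mem_filter, mem_upDominoes] at hd
    rw [mem_upBoxes, hX]
    refine ⟨?_, by omega⟩
    rw [show 2 * (((d.hi / 2).toNat : ℕ) : ℤ) + ε = d.hi by omega]
    exact hP.rank_lt hh hd.1.1 hd.1.2
  · intro d hd e he hde
    rw [Finset.mem_filter, mem_upDominoes] at hd he
    rw [Prod.mk.injEq] at hde
    exact hP.eq_of_rank_eq hd.1.1 he.1.1 hd.1.2 (by omega) hde.1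
  · rintro ⟨i, j⟩ hc
    rw [mem_upBoxes] at hc
    obtain ⟨k, rfl⟩ := Nat.exists_eq_add_of_le hc.2
    rw [hX] at hc
    obtain ⟨d, hd, hhi, rfl⟩ := hP.exists_rank hh (by omega) hc.1
    refine ⟨d, ?_, ?_⟩
    · rw [Finset.mem_filter, mem_upDominoes]; exact ⟨⟨hd, by omega⟩, by omega⟩
    · rw [Prod.mk.injEq]; exact ⟨rfl, by omega⟩
  · intro d hd
    rw [Finset.mem_filter, mem_upDominoes] at hd
    rw [← hT, show 2 * (((d.hi / 2).toNat : ℕ) : ℤ) + ε = d.hi by omega,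
      diagEntry_eq hP _ hd.1.1 hd.1.2]

theorem ShiftedSVDT.sum_pair (hh : IsProfile lam h) (hX : IsComponent X h 0)
    (hY : IsComponent Y h 1) (S : ShiftedSVDT lam) (T₁ : ShiftedSVT X) (T₂ : ShiftedSVT Y)
    (hE : diagEntry S.paving S.entry = pairEntry T₁ T₂) (F : Finset Letter → M) :
    ∑ p ∈ S.up, F p.2 =
      ∑ c ∈ upBoxes X, F (T₁.entry c) + ∑ c ∈ upBoxes Y, F (T₂.entry c) := by
  rw [S.sum_up, ← S.sum_component hh le_rfl zero_le_one hX T₁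
      (fun k i => by rw [hE, pairEntry_even]),
    ← S.sum_component hh zero_le_one le_rfl hY T₂ (fun k i => by rw [hE, pairEntry_odd]),
    ← Finset.sum_filter_add_sum_filter_not _ (fun d : Domino => d.hi % 2 = 0)]
  congr 2
  exact Finset.filter_congr fun d _ => by omega

end Pairs

/-! ### The bijection -/

section Bijection

variable {lam X Y : YoungDiagram} {h : ℤ → ℕ}

/-- The bijection between classes of shifted set-valued domino tableaux and pairs of shifted
set-valued tableaux. -/
theorem exists_bijective_pairs (hh : IsProfile lam h) (hX : IsComponent X h 0)
    (hY : IsComponent Y h 1) (hlam : IsShiftedPavable lam) :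
    ∃ Φ : SVDTClass lam → ShiftedSVT X × ShiftedSVT Y, Function.Bijective Φ ∧
      (∀ T : SVDTClass lam, T.weight = (Φ T).1.weight + (Φ T).2.weight) ∧
      (∀ T : SVDTClass lam, T.size = (Φ T).1.size + (Φ T).2.size) ∧
      ∀ T : SVDTClass lam, T.up.card = (upBoxes X).card + (upBoxes Y).card := by
  have hread : ∀ S : ShiftedSVDT lam, ∃ p : ShiftedSVT X × ShiftedSVT Y,
      pairEntry p.1 p.2 = diagEntry S.paving S.entry := fun S => by
    obtain ⟨T₁, T₂, hT⟩ := (S.isDiagTableau_diagEntry hh).exists_pairEntry_eq hX hY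
      (S.diagEntry_eq_empty hh)
    exact ⟨(T₁, T₂), hT⟩
  choose f hf using hread
  have hwd : ∀ S S' : ShiftedSVDT lam, S.up = S'.up → f S = f S' := fun S S' hup => by
    have := pairEntry_injective (((hf S).trans (S.diagEntry_eq_of_up_eq hup)).trans (hf S').symm)
    exact Prod.ext this.1 this.2
  refine ⟨Quotient.lift f hwd, ⟨?_, ?_⟩, ?_, ?_, ?_⟩
  · intro T T'
    induction T using Quotient.inductionOn
    induction T' using Quotient.inductionOn
    rename_i S S'
    intro hfS
    refine Quotient.sound (ShiftedSVDT.up_eq_of_diagEntry_eq hh ?_)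
    rw [← hf, ← hf]
    change f S = f S' at hfS
    rw [hfS]
  · rintro ⟨T₁, T₂⟩
    obtain ⟨S, hS⟩ := ShiftedSVDT.exists_diagEntry_eq hh hlam
      (isDiagTableau_pairEntry hX hY T₁ T₂) (pairEntry_eq_empty hX hY T₁ T₂)
    have := pairEntry_injective ((hf S).trans hS)
    exact ⟨Quotient.mk _ S, Prod.ext this.1 this.2⟩
  · intro T
    induction T using Quotient.inductionOn
    rename_i S
    exact S.sum_pair hh hX hY _ _ (hf S).symm contentOf
  · intro T
    induction T using Quotient.inductionOn
    rename_i S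
    exact S.sum_pair hh hX hY _ _ (hf S).symm Finset.card
  · intro T
    induction T using Quotient.inductionOn
    rename_i S
    have := ShiftedSVDT.sum_pair hh hX hY S _ _ (hf S).symm fun _ => 1
    simp only [Finset.sum_const, smul_eq_mul, mul_one] at this
    exact this

end Bijection

/-! ### Rows of a diagram that reach beyond a diagonal -/

theorem lt_count_iff {p : ℕ → Prop} [DecidablePred p] (hp : ∀ i j, i ≤ j → p j → p i) {i N : ℕ} :
    i < Nat.count p N ↔ i < N ∧ p i := by
  constructor
  · intro h
    have hN : i < N := h.trans_le (Nat.count_le p)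
    refine ⟨hN, ?_⟩
    by_contra hpi
    obtain ⟨k, rfl⟩ := Nat.exists_eq_add_of_le hN.le
    rw [Nat.count_add, (Nat.count_iff_forall_not (p := fun j => p (i + j))).2
      fun j _ hpj => hpi (hp i (i + j) (by omega) hpj)] at h
    exact absurd h (not_lt.2 (Nat.count_le p))
  · rintro ⟨hN, hpi⟩
    have : Nat.count p (i + 1) = i + 1 :=
      Nat.count_of_forall fun j hj => hp j i (by omega) hpi
    have h2 := Nat.count_monotone p (show i + 1 ≤ N from hN)
    omega

/-- The number of rows `i` of `X` with `X.rowLen i - i > k`; for `k < 0`, this includes the empty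
rows `i` with `i < -k`. -/
def diagCount (X : YoungDiagram) (k : ℤ) : ℕ :=
  Nat.count (fun i : ℕ => k < (X.rowLen i : ℤ) - i) (X.colLen 0 + k.natAbs)

theorem rowLen_sub_anti (X : YoungDiagram) {k : ℤ} {i j : ℕ} (hij : i ≤ j)
    (hj : k < (X.rowLen j : ℤ) - j) : k < (X.rowLen i : ℤ) - i := by
  have := X.rowLen_anti i j hij
  omega

theorem rowLen_eq_zero_iff {X : YoungDiagram} {i : ℕ} : X.rowLen i = 0 ↔ X.colLen 0 ≤ i := by
  rw [← not_lt, ← YoungDiagram.mem_iff_lt_colLen, YoungDiagram.mem_iff_lt_rowLen]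
  omega

theorem lt_diagCount {X : YoungDiagram} {k : ℤ} {i : ℕ} :
    i < diagCount X k ↔ k < (X.rowLen i : ℤ) - i := by
  rw [diagCount, lt_count_iff fun i j => rowLen_sub_anti X, and_iff_right_iff_imp]
  intro h
  by_contra hcon
  have := (rowLen_eq_zero_iff (X := X) (i := i)).2 (by omega)
  omega

theorem diagCount_eq_count {X : YoungDiagram} {k : ℤ} {N : ℕ} (h1 : X.colLen 0 ≤ N) (h2 : -k ≤ N) :
    diagCount X k = Nat.count (fun i : ℕ => k < (X.rowLen i : ℤ) - i) N := by
  refine eq_of_forall_lt_iff fun i => ?_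
  rw [lt_diagCount, lt_count_iff fun i j => rowLen_sub_anti X, iff_and_self]
  intro h
  by_contra hcon
  have := (rowLen_eq_zero_iff (X := X) (i := i)).2 (by omega)
  omega

theorem mem_iff_lt_diagCount {X : YoungDiagram} {r c : ℕ} :
    (r, c) ∈ X ↔ r < diagCount X ((c : ℤ) - r) := by
  rw [lt_diagCount, YoungDiagram.mem_iff_lt_rowLen]
  omega

/-- If the numbers `c * (X.rowLen i + (n - 1 - i)) + ρ` are the components of a list, then the rows
that reach beyond a diagonal can be counted in that list. -/
theorem diagCount_eq_countP {X : YoungDiagram} {e : List ℕ} {c ρ : ℕ} (hc : 0 < c)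
    (hX : X.colLen 0 ≤ e.length)
    (he : ∀ i (hi : i < e.length), e[i] = c * (X.rowLen i + (e.length - 1 - i)) + ρ) (k : ℤ) :
    diagCount X k = e.countP (fun x : ℕ => decide (c * (k + e.length - 1) + ρ < (x : ℤ))) +
      (-k - e.length).toNat := by
  have hmap : e = (List.range e.length).map
      fun i => c * (X.rowLen i + (e.length - 1 - i)) + ρ := by
    refine List.ext_getElem (by simp) fun i h1 h2 => ?_
    rw [he i h1]; simp
  rw [diagCount_eq_count (N := e.length + (-k - e.length).toNat) (by omega) (by omega),
    Nat.count_add]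
  congr 1
  · conv_rhs => rw [hmap]
    rw [List.countP_map, Nat.count, List.length_map, List.length_range]
    refine List.countP_congr fun i hi => ?_
    rw [List.mem_range] at hi
    simp only [Function.comp_apply, decide_eq_true_eq]
    push_cast [show i ≤ e.length - 1 by omega, show 1 ≤ e.length by omega]
    have hc' : (0 : ℤ) < c := by exact_mod_cast hc
    rw [add_lt_add_iff_right, mul_lt_mul_iff_right₀ hc']
    omega
  · refine eq_of_forall_lt_iff fun i => ?_
    rw [lt_count_iff]
    · rw [and_iff_left_iff_imp]
      intro hi
      have := (rowLen_eq_zero_iff (X := X) (i := e.length + i)).2 (by omega)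
      omega
    · intro i j hij
      exact rowLen_sub_anti X (by omega)

/-! ### The 2-quotient in terms of row lengths -/

theorem rowLens_getD (X : YoungDiagram) (i : ℕ) : X.rowLens.getD i 0 = X.rowLen i := by
  by_cases hi : i < X.rowLens.length
  · rw [List.getD_eq_getElem _ _ hi, YoungDiagram.get_rowLens]
  · rw [List.getD_eq_default _ _ (not_lt.1 hi)]
    rw [YoungDiagram.length_rowLens, not_lt] at hi
    exact (rowLen_eq_zero_iff.2 hi).symm

theorem getD_filter_ne_zero {A : List ℕ} (hA : A.Pairwise (· ≥ ·)) (i : ℕ) :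
    (A.filter fun a => a ≠ 0).getD i 0 = A.getD i 0 := by
  induction A generalizing i with
  | nil => simp
  | cons a A ih =>
    rw [List.pairwise_cons] at hA
    by_cases ha : a = 0
    · subst ha
      have h0 : ∀ b ∈ A, b = 0 := fun b hb => Nat.le_zero.1 (hA.1 b hb)
      have h1 : A.filter (fun a => a ≠ 0) = [] := by
        rw [List.filter_eq_nil_iff]
        intro b hb
        simp [h0 b hb]
      have h2 := ih hA.2
      rw [h1] at h2
      simp only [ne_eq, not_true_eq_false, decide_false, Bool.false_eq_true, not_false_eq_true,
        List.filter_cons_of_neg]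
      simp only [ne_eq] at h1
      rw [h1]
      rcases i with _ | i
      · simp
      · simpa using h2 i
    · rw [List.filter_cons_of_pos (by simpa using ha)]
      rcases i with _ | i
      · simp
      · simpa using ih hA.2 i

/-- Halved differences of `e` and `(2 * (m - 1) + r, …, 2 + r, r)`. -/
def halvedDiff (r : ℕ) (e : List ℕ) : List ℕ :=
  e.mapIdx fun i a => (a - (2 * (e.length - 1 - i) + r)) / 2

theorem halvedDiff_cons (r x : ℕ) (e : List ℕ) :
    halvedDiff r (x :: e) = (x - (2 * e.length + r)) / 2 :: halvedDiff r e := by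
  rw [halvedDiff, List.mapIdx_cons, halvedDiff]
  refine List.cons_eq_cons.2 ⟨by simp, ?_⟩
  congr 1
  funext i a
  rw [List.length_cons]
  congr 3
  omega

theorem halvedDiff_length (r : ℕ) (e : List ℕ) : (halvedDiff r e).length = e.length := by
  simp [halvedDiff]

/-- For a strictly decreasing list of numbers congruent to `r` modulo `2`, the subtraction and the
division in `halvedDiff` are exact, and the result is weakly decreasing. -/
theorem halvedDiff_spec {r : ℕ} (hr : r < 2) {e : List ℕ} (he : e.Pairwise (· > ·))
    (hpar : ∀ x ∈ e, x % 2 = r) :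
    (halvedDiff r e).Pairwise (· ≥ ·) ∧
      (∀ i (hi : i < e.length),
        e[i] = 2 * ((halvedDiff r e).getD i 0 + (e.length - 1 - i)) + r) := by
  induction e with
  | nil => simp [halvedDiff]
  | cons x e ih =>
    rw [List.pairwise_cons] at he
    obtain ⟨ih1, ih2⟩ := ih he.2 fun y hy => hpar y (List.mem_cons_of_mem _ hy)
    have hx := hpar x List.mem_cons_self
    have hlen := halvedDiff_length r e
    have hge : ∀ i (hi : i < e.length), (halvedDiff r e).getD i 0 ≤ (halvedDiff r e).getD 0 0 := by
      intro i hi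
      rcases Nat.eq_zero_or_pos i with rfl | hpos
      · exact le_rfl
      · rw [List.getD_eq_getElem _ _ (by omega), List.getD_eq_getElem _ _ (by omega)]
        exact List.pairwise_iff_getElem.1 ih1 0 i (by omega) (by omega) hpos
    have hx2 : x = 2 * ((x - (2 * e.length + r)) / 2 + e.length) + r ∧
        ((halvedDiff r e).getD 0 0 ≤ (x - (2 * e.length + r)) / 2) := by
      rcases Nat.eq_zero_or_pos e.length with h0 | hpos
      · refine ⟨by omega, ?_⟩
        rw [List.getD_eq_default _ _ (by omega)]
        omega
      · have h1 := ih2 0 hpos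
        have h2 : e[0] < x := he.1 _ (List.getElem_mem hpos)
        omega
    rw [halvedDiff_cons]
    refine ⟨List.pairwise_cons.2 ⟨?_, ih1⟩, ?_⟩
    · intro y hy
      obtain ⟨i, hi, rfl⟩ := List.getElem_of_mem hy
      have := hge i (by omega)
      rw [List.getD_eq_getElem _ _ hi] at this
      omega
    · intro i hi
      rcases i with _ | i
      · simpa using hx2.1
      · rw [List.length_cons] at hi
        have := ih2 i (by omega)
        simp only [List.getElem_cons_succ, List.getD_cons_succ, List.length_cons]
        rw [this]
        omega

theorem rowLen_of_quotientPart {X : YoungDiagram} {r : ℕ} (hr : r < 2) {e : List ℕ}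
    (he : e.Pairwise (· > ·)) (hpar : ∀ x ∈ e, x % 2 = r) (hX : quotientPart r e = X.rowLens) :
    X.colLen 0 ≤ e.length ∧
      ∀ i (hi : i < e.length), e[i] = 2 * (X.rowLen i + (e.length - 1 - i)) + r := by
  obtain ⟨h1, h2⟩ := halvedDiff_spec hr he hpar
  have h3 : ∀ i, X.rowLen i = (halvedDiff r e).getD i 0 := fun i => by
    rw [← rowLens_getD, ← hX, ← getD_filter_ne_zero h1]
    rfl
  refine ⟨?_, fun i hi => by rw [h3]; exact h2 i hi⟩
  rw [← YoungDiagram.length_rowLens, ← hX, quotientPart]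
  exact (List.length_filter_le _ _).trans (by simp)

theorem betaList_length (w : List ℕ) : (betaList w).length = w.length := by simp [betaList]

theorem betaList_getElem (lam : YoungDiagram) {i : ℕ} (hi : i < (betaList lam.rowLens).length) :
    (betaList lam.rowLens)[i] =
      lam.rowLen i + ((betaList lam.rowLens).length - 1 - i) := by
  rw [betaList_length]
  simp [betaList, YoungDiagram.get_rowLens]

theorem betaList_pairwise (lam : YoungDiagram) : (betaList lam.rowLens).Pairwise (· > ·) := by
  rw [List.pairwise_iff_getElem]
  intro i j hi hj hij
  rw [betaList_getElem, betaList_getElem]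
  have := lam.rowLen_anti i j hij.le
  omega

/-! ### A paved diagram has an empty 2-core -/

theorem sum_neg_one_cells {lam : YoungDiagram} {P : Finset Domino} (hP : IsPaving lam P) :
    ∑ x ∈ lam.cells, (-1 : ℤ) ^ (x.1 + x.2) = 0 := by
  rw [← hP.cover, Finset.sum_biUnion fun d hd e he hde => hP.disjoint d hd e he hde]
  refine Finset.sum_eq_zero fun d _ => ?_
  rcases d with ⟨a, b, v⟩
  cases v <;> simp [Domino.boxes, Domino.first, Domino.second] <;> ring

theorem sum_neg_one_rows {lam : YoungDiagram} {P : Finset Domino} (hP : IsPaving lam P) :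
    ∑ r ∈ Finset.range (lam.colLen 0), (-1 : ℤ) ^ r *
      (if Even (lam.rowLen r) then 0 else 1) = 0 := by
  refine Eq.trans ?_ (sum_neg_one_cells hP)
  rw [Finset.sum_finset_product lam.cells (Finset.range (lam.colLen 0))
    fun r => Finset.range (lam.rowLen r)]
  · refine Finset.sum_congr rfl fun r _ => ?_
    simp only [pow_add]
    rw [← Finset.mul_sum, neg_one_geom_sum]
  · rintro ⟨r, c⟩
    rw [YoungDiagram.mem_cells, Finset.mem_range, Finset.mem_range,
      YoungDiagram.mem_iff_lt_rowLen, iff_and_self]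
    intro h
    by_contra hcon
    have := (rowLen_eq_zero_iff (X := lam) (i := r)).2 (not_lt.1 hcon)
    omega

/-- There are as many even as odd numbers in `betaList`, up to one more even number if the number of
parts is odd: this is read off from the coloring of the boxes by the parity of their diagonals. -/
theorem card_even_betaList {lam : YoungDiagram} {P : Finset Domino} (hP : IsPaving lam P) :
    ((betaList lam.rowLens).filter fun a => a % 2 = 0).length =
      ((betaList lam.rowLens).filter fun a => a % 2 = 1).length + (lam.colLen 0) % 2 := by
  set K := lam.colLen 0 with hK
  have hlen : (betaList lam.rowLens).length = K := by
    rw [betaList_length, YoungDiagram.length_rowLens]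
  have hmap : betaList lam.rowLens =
      (List.range K).map fun i => lam.rowLen i + (K - 1 - i) := by
    refine List.ext_getElem (by simp [hlen]) fun i h1 h2 => ?_
    rw [betaList_getElem, hlen]
    simp
  have hcount : ∀ q : ℕ → Bool, (((betaList lam.rowLens).filter q).length : ℤ) =
      ∑ i ∈ Finset.range K, if q (lam.rowLen i + (K - 1 - i)) then 1 else 0 := by
    intro q
    rw [← List.countP_eq_length_filter, hmap, List.countP_map, ← Finset.sum_filter,
      Finset.sum_const, nsmul_one]
    norm_cast
    rw [← Nat.count_eq_card_filter_range, Nat.count]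
    simp [Function.comp_def]
  rw [← Nat.cast_inj (R := ℤ), Nat.cast_add, hcount, hcount, ← sub_eq_iff_eq_add', ← Finset.sum_sub_distrib]
  have hterm : ∀ i ∈ Finset.range K,
      ((if decide ((lam.rowLen i + (K - 1 - i)) % 2 = 0) then (1 : ℤ) else 0) -
        if decide ((lam.rowLen i + (K - 1 - i)) % 2 = 1) then 1 else 0) =
      (-1) ^ (K - 1) * ((-1) ^ i -
        2 * ((-1) ^ i * (if Even (lam.rowLen i) then 0 else 1))) := by
    intro i hi
    rw [Finset.mem_range] at hi
    have h1 : (-1 : ℤ) ^ (K - 1) = (-1) ^ (K - 1 - i) * (-1) ^ i := by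
      rw [← pow_add]; congr 1; omega
    have h2 : (-1 : ℤ) ^ i * (-1) ^ i = 1 := by
      rw [← pow_add, ← two_mul, pow_mul]; simp
    rw [h1, show (-1 : ℤ) ^ (K - 1 - i) * (-1) ^ i * ((-1) ^ i -
        2 * ((-1) ^ i * (if Even (lam.rowLen i) then 0 else 1))) =
      (-1 : ℤ) ^ (K - 1 - i) * ((-1) ^ i * (-1) ^ i) *
        (1 - 2 * (if Even (lam.rowLen i) then 0 else 1)) by ring, h2, mul_one]
    generalize K - 1 - i = b
    generalize lam.rowLen i = a
    rcases Nat.even_or_odd a with ha | ha <;> rcases Nat.even_or_odd b with hb | hb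
    · rw [if_pos ha, hb.neg_one_pow]
      rw [Nat.even_iff] at ha hb
      simp [show (a + b) % 2 = 0 by omega]
    · rw [if_pos ha, hb.neg_one_pow]
      rw [Nat.even_iff] at ha
      rw [Nat.odd_iff] at hb
      simp [show (a + b) % 2 = 1 by omega]
    · rw [if_neg (Nat.not_even_iff_odd.2 ha), hb.neg_one_pow]
      rw [Nat.even_iff] at hb
      rw [Nat.odd_iff] at ha
      simp [show (a + b) % 2 = 1 by omega]
    · rw [if_neg (Nat.not_even_iff_odd.2 ha), hb.neg_one_pow]
      rw [Nat.odd_iff] at ha hb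
      simp [show (a + b) % 2 = 0 by omega]
  rw [Finset.sum_congr rfl hterm, ← Finset.mul_sum, Finset.sum_sub_distrib, ← Finset.mul_sum,
    sum_neg_one_rows hP, neg_one_geom_sum]
  rcases Nat.even_or_odd K with hE | hO
  · rw [if_pos hE]
    rw [Nat.even_iff] at hE
    simp only [mul_zero, sub_zero]
    omega
  · have : Even (K - 1) := by rw [Nat.odd_iff] at hO; rw [Nat.even_iff]; omega
    rw [if_neg (Nat.not_even_iff_odd.2 hO), this.neg_one_pow]
    rw [Nat.odd_iff] at hO
    simp only [mul_zero, sub_zero, mul_one]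
    omega

/-! ### The profile of a diagram with given 2-quotient -/

/-- The profile in which the dominoes of type 1 belong to `X` and those of type 2 to `Y`. -/
def profileOf (X Y : YoungDiagram) (m : ℤ) : ℕ :=
  if m % 2 = 0 then diagCount X (m / 2) else diagCount Y (m / 2)

theorem LastPartGE.lt_rowLen {X : YoungDiagram} (hX : LastPartGE X.rowLens) {i : ℕ}
    (hi : X.rowLen i ≠ 0) : i < X.rowLen i := by
  rw [Ne, rowLen_eq_zero_iff, not_le] at hi
  have hlen := X.length_rowLens
  have hne : X.rowLens ≠ [] := by
    rw [← List.length_pos_iff, hlen]; omega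
  have h1 := hX (X.rowLens.getLast hne) (List.getLast_mem_getLast? hne)
  rw [List.getLast_eq_getElem, YoungDiagram.get_rowLens, hlen] at h1
  have h2 := X.rowLen_anti i (X.colLen 0 - 1) (by omega)
  omega

theorem diagCount_of_nonpos {X : YoungDiagram} (hX : LastPartGE X.rowLens) {k : ℤ} (hk : k ≤ 0) :
    diagCount X k = max (diagCount X 0) (-k).toNat := by
  refine eq_of_forall_lt_iff fun i => ?_
  rw [lt_max_iff, lt_diagCount, lt_diagCount]
  constructor
  · intro h
    by_cases h0 : X.rowLen i = 0
    · right; omega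
    · have := hX.lt_rowLen h0
      left; omega
  · rintro (h | h) <;> omega

theorem isComponent_profileOf_left (X Y : YoungDiagram) : IsComponent X (profileOf X Y) 0 := by
  intro i k
  rw [profileOf, if_pos (by omega), lt_diagCount, YoungDiagram.mem_iff_lt_rowLen]
  omega

theorem isComponent_profileOf_right (X Y : YoungDiagram) : IsComponent Y (profileOf X Y) 1 := by
  intro i k
  rw [profileOf, if_neg (by omega), lt_diagCount, YoungDiagram.mem_iff_lt_rowLen]
  omega

theorem isProfile_profileOf {lam X Y : YoungDiagram} (hX : LastPartGE X.rowLens)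
    (hY : LastPartGE Y.rowLens)
    (hlam : ∀ m, diagCount lam m = profileOf X Y m + profileOf X Y (m + 1)) :
    IsProfile lam (profileOf X Y) where
  mem_iff r c := by rw [mem_iff_lt_diagCount, hlam]
  anti s := by
    have key : ∀ (Z : YoungDiagram) (k : ℤ), diagCount Z (k + 1) ≤ diagCount Z k := fun Z k => by
      refine le_of_forall_lt fun i hi => ?_
      rw [lt_diagCount] at hi ⊢
      omega
    have e : (s + 2) / 2 = s / 2 + 1 := by omega
    unfold profileOf
    rw [e, Int.add_emod_right]
    split
    · exact key X _
    · exact key Y _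
  step s := by
    have key : ∀ (Z : YoungDiagram) (k : ℤ), diagCount Z k ≤ diagCount Z (k + 1) + 1 :=
        fun Z k => by
      refine le_of_forall_lt fun i hi => ?_
      rcases i with _ | i
      · omega
      · have hi' : i < diagCount Z (k + 1) := by
          rw [lt_diagCount] at hi ⊢
          have := Z.rowLen_anti i (i + 1) (by omega)
          omega
        omega
    have e : (s + 2) / 2 = s / 2 + 1 := by omega
    unfold profileOf
    rw [e, Int.add_emod_right]
    split
    · exact key X _
    · exact key Y _
  low s hs := by
    have e : s % 2 / 2 = 0 := by omega
    unfold profileOf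
    rw [Int.emod_emod, e]
    split
    · exact diagCount_of_nonpos hX (by omega)
    · exact diagCount_of_nonpos hY (by omega)
  eventually_zero := by
    have key : ∀ (Z : YoungDiagram) (k : ℤ), Z.rowLen 0 ≤ k → diagCount Z k = 0 := fun Z k hk => by
      by_contra h
      have := lt_diagCount.1 (Nat.pos_of_ne_zero h)
      omega
    refine ⟨2 * (X.rowLen 0 + Y.rowLen 0), fun s hs => ?_⟩
    unfold profileOf
    split
    · exact key X _ (by omega)
    · exact key Y _ (by omega)

/-- The diagonals of a paved diagram and of its 2-quotient. The roles of the two components depend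
on the parity of the number of parts. -/
theorem diagCount_eq_of_isTwoQuotient {lam μ ν : YoungDiagram} {P : Finset Domino}
    (hP : IsPaving lam P) (hq : IsTwoQuotient lam μ ν) :
    (∀ m, diagCount lam m = profileOf μ ν m + profileOf μ ν (m + 1)) ∨
      ∀ m, diagCount lam m = profileOf ν μ m + profileOf ν μ (m + 1) := by
  have hbal := card_even_betaList hP
  rw [IsTwoQuotient, twoQuotient, Prod.mk.injEq] at hq
  obtain ⟨hq1, hq2⟩ := hq
  have hpw := betaList_pairwise lam
  have hget := fun i hi => betaList_getElem lam (i := i) hi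
  have hlen : (betaList lam.rowLens).length = lam.colLen 0 := by
    rw [betaList_length, YoungDiagram.length_rowLens]
  have hodd : (betaList lam.rowLens).filter (fun a => decide (a % 2 = 1)) =
      (betaList lam.rowLens).filter (fun a => !decide (a % 2 = 0)) := by
    refine List.filter_congr fun a _ => ?_
    rcases Nat.mod_two_eq_zero_or_one a with h | h <;> simp [h]
  have hsum := (betaList lam.rowLens).length_eq_length_filter_add
    (fun a => decide (a % 2 = 0))
  rw [← hodd, hlen] at hsum
  obtain ⟨ce, he⟩ := rowLen_of_quotientPart (by norm_num) (hpw.filter _)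
    (fun x hx => by simpa using (List.mem_filter.1 hx).2) hq1
  obtain ⟨co, ho⟩ := rowLen_of_quotientPart (by norm_num) (hpw.filter _)
    (fun x hx => by simpa using (List.mem_filter.1 hx).2) hq2
  have hL := diagCount_eq_countP (X := lam) (e := betaList lam.rowLens) (c := 1) (ρ := 0)
    one_pos hlen.ge (fun i hi => by rw [hget i hi]; ring)
  have hM := diagCount_eq_countP two_pos ce he
  have hN := diagCount_eq_countP two_pos co ho
  have hsplit : ∀ p : ℕ → Bool, (betaList lam.rowLens).countP p =
      ((betaList lam.rowLens).filter fun a => decide (a % 2 = 0)).countP p +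
        ((betaList lam.rowLens).filter fun a => decide (a % 2 = 1)).countP p := by
    intro p
    rw [hodd]
    exact List.countP_eq_countP_filter_add _ _ _
  set ev := (betaList lam.rowLens).filter fun a => decide (a % 2 = 0) with hev
  set od := (betaList lam.rowLens).filter fun a => decide (a % 2 = 1) with hod
  have cev : ∀ a b : ℤ, a / 2 = b / 2 → ev.countP (fun x : ℕ => decide (a < (x : ℤ))) =
      ev.countP (fun x : ℕ => decide (b < (x : ℤ))) := by
    intro a b hab
    refine List.countP_congr fun x hx => ?_
    have : x % 2 = 0 := by simpa using (List.mem_filter.1 hx).2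
    simp only [decide_eq_true_eq]
    omega
  have cod : ∀ a b : ℤ, (a + 1) / 2 = (b + 1) / 2 → od.countP (fun x : ℕ => decide (a < (x : ℤ))) =
      od.countP (fun x : ℕ => decide (b < (x : ℤ))) := by
    intro a b hab
    refine List.countP_congr fun x hx => ?_
    have : x % 2 = 1 := by simpa using (List.mem_filter.1 hx).2
    simp only [decide_eq_true_eq]
    omega
  rw [hlen] at hL
  push_cast at hM hN
  rcases Nat.even_or_odd (lam.colLen 0) with hK | hK
  · left
    rw [Nat.even_iff] at hK
    intro m
    rw [hL, hsplit]
    unfold profileOf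
    rcases Int.emod_two_eq_zero_or_one m with hm | hm
    · rw [if_pos hm, if_neg (by omega), hM, hN]
      rw [cev _ (2 * (m / 2 + ev.length - 1) + 0) (by push_cast; omega),
        cod _ (2 * ((m + 1) / 2 + od.length - 1) + 1) (by push_cast; omega)]
      omega
    · rw [if_neg (by omega), if_pos (by omega), hM, hN]
      rw [cev _ (2 * ((m + 1) / 2 + ev.length - 1) + 0) (by push_cast; omega),
        cod _ (2 * (m / 2 + od.length - 1) + 1) (by push_cast; omega)]
      omega
  · right
    rw [Nat.odd_iff] at hK
    intro m
    rw [hL, hsplit]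
    unfold profileOf
    rcases Int.emod_two_eq_zero_or_one m with hm | hm
    · rw [if_pos hm, if_neg (by omega), hM, hN]
      rw [cev _ (2 * ((m + 1) / 2 + ev.length - 1) + 0) (by push_cast; omega),
        cod _ (2 * (m / 2 + od.length - 1) + 1) (by push_cast; omega)]
      omega
    · rw [if_neg (by omega), if_pos (by omega), hM, hN]
      rw [cev _ (2 * (m / 2 + ev.length - 1) + 0) (by push_cast; omega),
        cod _ (2 * ((m + 1) / 2 + od.length - 1) + 1) (by push_cast; omega)]
      omega

/-! ### Finiteness and formal sums -/

theorem index_mem_support_contentOf {A : Finset Letter} {a : Letter} (ha : a ∈ A) :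
    contentOf A a.index ≠ 0 := by
  have h : Finsupp.single a.index 1 ≤ contentOf A :=
    Finset.single_le_sum (f := fun a : Letter => Finsupp.single a.index (1 : ℕ))
      (fun _ _ => zero_le) ha
  have := h a.index
  rw [Finsupp.single_eq_same] at this
  omega

namespace ShiftedSVT

variable {X : YoungDiagram}

theorem weight_index_ne_zero (T : ShiftedSVT X) {c : ℕ × ℕ} {a : Letter} (ha : a ∈ T.entry c) :
    T.weight a.index ≠ 0 := by
  have hc : c ∈ upBoxes X := by
    by_contra hc
    rw [T.entry_eq_empty c hc] at ha
    simp at ha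
  have h : contentOf (T.entry c) ≤ T.weight :=
    Finset.single_le_sum (f := fun c => contentOf (T.entry c)) (fun _ _ => zero_le) hc
  have h1 := h a.index
  have h2 := index_mem_support_contentOf ha
  omega

theorem finite_weight_eq (X : YoungDiagram) (α : ℕ+ →₀ ℕ) :
    {T : ShiftedSVT X | T.weight = α}.Finite := by
  classical
  let L : Finset Letter := (α.support ×ˢ (Finset.univ : Finset Bool)).image toLex
  have hinj : Function.Injective fun (T : ShiftedSVT X) (c : upBoxes X) => T.entry c := by
    intro T T' h
    refine ext_entry (funext fun c => ?_)
    by_cases hc : c ∈ upBoxes X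
    · exact congrFun h ⟨c, hc⟩
    · rw [T.entry_eq_empty c hc, T'.entry_eq_empty c hc]
  have hfin :
      {f : upBoxes X → Finset Letter | ∀ c, f c ∈ (L.powerset : Set (Finset Letter))}.Finite :=
    Set.Finite.pi' fun _ => Finset.finite_toSet _
  refine (hfin.preimage hinj.injOn).subset ?_
  rintro T rfl c
  rw [Finset.mem_coe, Finset.mem_powerset]
  intro a ha
  refine Finset.mem_image.2 ⟨ofLex a, ?_, rfl⟩
  rw [Finset.mem_product]
  exact ⟨Finsupp.mem_support_iff.2 (T.weight_index_ne_zero ha), Finset.mem_univ _⟩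

theorem card_upBoxes_le_size (T : ShiftedSVT X) : (upBoxes X).card ≤ T.size := by
  rw [Finset.card_eq_sum_ones]
  exact Finset.sum_le_sum fun c hc => Finset.card_pos.2 (T.entry_nonempty c hc)

end ShiftedSVT

section FormalSum

variable {ι κ : Type*}

theorem coeff_formalSum {wt : ι → (ℕ+ →₀ ℕ)} (hwt : ∀ α, {t | wt t = α}.Finite) (sgn : ι → ℤ)
    (α : ℕ+ →₀ ℕ) :
    MvPowerSeries.coeff α (formalSum wt sgn) = ∑ t ∈ (hwt α).toFinset, sgn t := by
  rw [← finsum_mem_eq_finite_toFinset_sum, ← finsum_set_coe_eq_finsum_mem]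
  rfl

theorem finite_weight_add {w₁ : ι → (ℕ+ →₀ ℕ)} {w₂ : κ → (ℕ+ →₀ ℕ)}
    (h₁ : ∀ α, {t | w₁ t = α}.Finite) (h₂ : ∀ α, {t | w₂ t = α}.Finite) (α : ℕ+ →₀ ℕ) :
    {t : ι × κ | w₁ t.1 + w₂ t.2 = α}.Finite := by
  classical
  refine Set.Finite.subset (Set.Finite.biUnion (Finset.HasAntidiagonal.antidiagonal α).finite_toSet
    fun p _ => (h₁ p.1).prod (h₂ p.2)) ?_
  intro t ht
  exact Set.mem_biUnion (x := (w₁ t.1, w₂ t.2)) (Finset.mem_coe.2 (Finset.HasAntidiagonal.mem_antidiagonal.2 ht))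
    ⟨rfl, rfl⟩

theorem formalSum_mul {w₁ : ι → (ℕ+ →₀ ℕ)} {w₂ : κ → (ℕ+ →₀ ℕ)}
    (h₁ : ∀ α, {t | w₁ t = α}.Finite) (h₂ : ∀ α, {t | w₂ t = α}.Finite) (s₁ : ι → ℤ) (s₂ : κ → ℤ) :
    formalSum w₁ s₁ * formalSum w₂ s₂ =
      formalSum (fun t : ι × κ => w₁ t.1 + w₂ t.2) fun t => s₁ t.1 * s₂ t.2 := by
  classical
  ext α
  rw [MvPowerSeries.coeff_mul, coeff_formalSum (finite_weight_add h₁ h₂),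
    ← Finset.sum_fiberwise_of_maps_to (t := Finset.HasAntidiagonal.antidiagonal α)
      (g := fun t : ι × κ => (w₁ t.1, w₂ t.2))]
  · refine Finset.sum_congr rfl fun p hp => ?_
    rw [coeff_formalSum h₁, coeff_formalSum h₂, Finset.sum_mul_sum, ← Finset.sum_product']
    refine Finset.sum_congr ?_ fun _ _ => rfl
    ext t
    rw [Finset.HasAntidiagonal.mem_antidiagonal] at hp
    simp only [Finset.mem_product, Set.Finite.mem_toFinset, Set.mem_ofPred_eq, Finset.mem_filter,
      Prod.ext_iff]
    constructor
    · rintro ⟨h3, h4⟩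
      exact ⟨by rw [h3, h4, hp], h3, h4⟩
    · exact fun h => h.2
  · intro t ht
    rw [Set.Finite.mem_toFinset] at ht
    exact Finset.HasAntidiagonal.mem_antidiagonal.2 ht

theorem formalSum_comp_bijective {f : ι → κ} (hf : Function.Bijective f) {wt : ι → (ℕ+ →₀ ℕ)}
    {wt' : κ → (ℕ+ →₀ ℕ)} {sgn : ι → ℤ} {sgn' : κ → ℤ} (hwt : ∀ t, wt t = wt' (f t))
    (hsgn : ∀ t, sgn t = sgn' (f t)) : formalSum wt sgn = formalSum wt' sgn' := by
  funext α
  refine finsum_eq_of_bijective (fun t => ⟨f t.1, by rw [← hwt]; exact t.2⟩) ⟨?_, ?_⟩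
    fun t => hsgn t.1
  · intro t t' h
    exact Subtype.ext (hf.1 (congrArg Subtype.val h))
  · rintro ⟨k, hk⟩
    obtain ⟨t, rfl⟩ := hf.2 k
    exact ⟨⟨t, by rw [hwt]; exact hk⟩, rfl⟩

end FormalSum

/-- The factorization of the generating function of shifted set-valued domino tableaux, when the
dominoes of type 1 correspond to the boxes of `X` and those of type 2 to the boxes of `Y`. -/
theorem formalSum_eq_mul {lam X Y : YoungDiagram} {h : ℤ → ℕ} (hh : IsProfile lam h)
    (hX : IsComponent X h 0) (hY : IsComponent Y h 1) (hlam : IsShiftedPavable lam) :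
    (∀ α : ℕ+ →₀ ℕ, {T : SVDTClass lam | T.weight = α}.Finite) ∧
      GQ X * GQ Y = formalSum (SVDTClass.weight (lam := lam)) SVDTClass.sign := by
  obtain ⟨Φ, hΦ, hw, hs, hc⟩ := exists_bijective_pairs hh hX hY hlam
  refine ⟨fun α => ?_, ?_⟩
  · refine ((finite_weight_add (ShiftedSVT.finite_weight_eq X) (ShiftedSVT.finite_weight_eq Y)
      α).preimage hΦ.1.injOn).subset fun T hT => ?_
    exact (hw T).symm.trans hT
  · rw [GQ, GQ, formalSum_mul (ShiftedSVT.finite_weight_eq X) (ShiftedSVT.finite_weight_eq Y)]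
    refine (formalSum_comp_bijective hΦ hw fun T => ?_).symm
    have h1 := (Φ T).1.card_upBoxes_le_size
    have h2 := (Φ T).2.card_upBoxes_le_size
    rw [SVDTClass.sign, hs, hc, ShiftedSVT.sign, ShiftedSVT.sign, ← pow_add]
    congr 1
    omega

end ShiftedDomino

theorem mainTheorem4 (lam μ ν : YoungDiagram) (hlam : ShiftedDomino.IsShiftedPavable lam)
    (hq : ShiftedDomino.IsTwoQuotient lam μ ν) :
    (∀ α : ℕ+ →₀ ℕ, {T : ShiftedDomino.ShiftedSVT μ | T.weight = α}.Finite) ∧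
    (∀ α : ℕ+ →₀ ℕ, {T : ShiftedDomino.ShiftedSVT ν | T.weight = α}.Finite) ∧
    (∀ α : ℕ+ →₀ ℕ, {T : ShiftedDomino.SVDTClass lam | T.weight = α}.Finite) ∧
    ShiftedDomino.GQ μ * ShiftedDomino.GQ ν =
      ShiftedDomino.formalSum (ShiftedDomino.SVDTClass.weight (lam := lam))
        ShiftedDomino.SVDTClass.sign := by
  open ShiftedDomino in
  refine ⟨ShiftedSVT.finite_weight_eq μ, ShiftedSVT.finite_weight_eq ν, ?_⟩
  obtain ⟨P, hP⟩ := id hlam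
  have hμ := hP.lastPart_left
  have hν := hP.lastPart_right
  rw [show twoQuotient lam.rowLens = _ from hq] at hμ hν
  rcases diagCount_eq_of_isTwoQuotient hP.toIsPaving hq with h | h
  · exact formalSum_eq_mul (isProfile_profileOf hμ hν h) (isComponent_profileOf_left μ ν)
      (isComponent_profileOf_right μ ν) hlam
  · rw [mul_comm]
    exact formalSum_eq_mul (isProfile_profileOf hν hμ h) (isComponent_profileOf_left ν μ)
      (isComponent_profileOf_right ν μ) hlam
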